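/- **Setting.** Let $(X,Y)$ have distribution $P$ on $\mathcal X\times\mathcal Y$, let $\mu$ be the law of $X$, and write $\|\cdot\|_{L_2}$ for the norm of $L_2(\mu)$. Let $E$ be a linear space of measurable functions $\mathcal X\to\mathbb R$ contained in $L_2(\mu)$, and let $F\subset E$ be convex. Let $\bar\ell$ be a loss, $\ell_f(x,y)=\bar\ell(f(x),y)$, such that for some $L>0$, for all $f,g\in F$, all $(x,y)$ and all $\alpha\in[0,1]$, $$|\bar\ell(f(x),y)-\bar\ell(g(x),y)|\le L|f(x)-g(x)|,\qquad \bar\ell(\alpha f(x)+(1-\alpha)g(x),y)\le\alpha\bar\ell(f(x),y)+(1-\alpha)\bar\ell(g(x),y).$$ Let $f^*\in F$ minimize the risk over $F$, i.e. $P\mathcal L_f:=\mathbb E_P[\ell_f(X,Y)-\ell_{f^*}(X,Y)]\ge 0$ for all $f\in F$. Let $\phi:E\to[0,\infty)$ be even and convex with $\phi(0)=0$, and let $\eta>0$ satisfy $\phi(f+g)\le\eta(\phi(f)+\phi(g))$ for all $f,g\in F$. **Data.** Let $(X_i,Y_i)_{i=1}^N$ be the data ($N\ge1$) and $\{1,\dots,N\}=\mathcal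 I\cup\mathcal O$ an unknown partition. The pairs $(X_i,Y_i)_{i\in\mathcal I}$ are independent and, for all $i\in\mathcal I$ and $f\in F$, $\mathbb E(f-f^*)^2(X_i)=\|f-f^*\|_{L_2}^2$ and $\mathbb E[\ell_f(X_i,Y_i)-\ell_{f^*}(X_i,Y_i)]=P\mathcal L_f$. Nothing is assumed on $(X_i,Y_i)_{i\in\mathcal O}$. Let $B_1,\dots,B_S$ be a partition of $\{1,\dots,N\}$ into blocks of equal size $N/S$ (with $S$ dividing $N$), and put $$\mathrm{MOM}_S(\ell_f-\ell_g)=\mathrm{Med}_{1\le s\le S}\Big(\tfrac1{|B_s|}\sum_{i\in B_s}(\ell_f-\ell_g)(X_i,Y_i)\Big),$$ $$\hat f_S^\lambda\in\operatorname*{argmin}_{f\in F}\ \sup_{g\in F}\ \Big\{\mathrm{MOM}_S(\ell_f-\ell_g)+\lambda(\phi(f)-\phi(g))\Big\}.$$ **Complexity.** For $A>0$ and $r>0$ let $F_{A,r}=\{f\in F:\|f-f^*\|_{L_2}\le r,\ \phi(f-f^*)\le\eta(4+2/A)\phi(f^*)\}$; with i.i.d. Rademacher variables $\sigma_i$ independent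 of the informative data, let $$\tilde r(A)=\inf\Big\{r>0:\ \forall J\subset\mathcal I \text{ with } |J|\ge N/2,\ \ \mathbb E\sup_{f\in F_{A,r}}\Big|\sum_{i\in J}\sigma_i(f-f^*)(X_i)\Big|\le\frac{r^2|J|}{384AL}\Big\}$$ ($\inf\emptyset=\infty$), and $$C_{S,r}(A)=\max\Big(\tilde r(A)^2,\ 368A^2L^2\frac SN\Big).$$ Fix $\tilde A>0$ such that the local Bernstein condition holds: for every $f\in F$ with $\|f-f^*\|_{L_2}=\sqrt{C_{S,r}(\tilde A)}$ and $\phi(f-f^*)\le\eta(4+2/\tilde A)\phi(f^*)$, one has $\|f-f^*\|_{L_2}^2\le\tilde A\,P\mathcal L_f$. Assume (so that the suprema are measurable) that for every $r>0$ the class $F_{\tilde A,r}$ has a countable subset such that every element of $F_{\tilde A,r}$ is the pointwise limit of a sequence in that subset. **Theorem.** Let $S\ge 7|\mathcal O|/3$. Then, with probability at least $1-2\exp(-S/504)$, simultaneously for all $\lambda>C_{S,r}(\tilde A)/\phi(f^*)$ (no $\lambda$ if $\phi(f^*)=0$ or $C_{S,r}(\tilde A)=\infty$), every estimator $\hat f_S^\lambda$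 satisfies $$\phi(\hat f_S^\lambda-f^*)\le\eta(4+2/\tilde A)\,\phi(f^*),\qquad \|\hat f_S^\lambda-f^*\|_{L_2}\le(4+6\tilde A)\,\lambda\,\frac{\phi(f^*)}{\sqrt{C_{S,r}(\tilde A)}}.$$ -/

import Mathlib

open MeasureTheory ProbabilityTheory Filter Topology
open scoped ENNReal

noncomputable section

namespace MinmaxMOM

/-- `E` is a linear space of (genuine, everywhere defined) measurable functions that are square
integrable with respect to `μ`. -/
def IsL2Space {𝒳 : Type*} [MeasurableSpace 𝒳] (μ : Measure 𝒳) (E : Submodule ℝ (𝒳 → ℝ)) : Prop :=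
  ∀ f ∈ E, Measurable f ∧ MemLp f 2 μ

/-- The loss `ℓ_f(x, y) = ℓ(f(x), y)` is `L`-Lipschitz and convex in the prediction, on the values
taken by the functions of `F`. -/
structure IsLipschitzConvexLoss {𝒳 𝒴 : Type*} (F : Set (𝒳 → ℝ)) (ℓ : ℝ → 𝒴 → ℝ) (L : ℝ) :
    Prop where
  pos : 0 < L
  lipschitz : ∀ f ∈ F, ∀ g ∈ F, ∀ (x : 𝒳) (y : 𝒴), |ℓ (f x) y - ℓ (g x) y| ≤ L * |f x - g x|
  convex : ∀ α : ℝ, 0 ≤ α → α ≤ 1 → ∀ f ∈ F, ∀ g ∈ F, ∀ (x : 𝒳) (y : 𝒴),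
    ℓ (α * f x + (1 - α) * g x) y ≤ α * ℓ (f x) y + (1 - α) * ℓ (g x) y

/-- The excess risk `P 𝓛_f = E[ℓ(f(X), Y) - ℓ(f*(X), Y)]`, `(X, Y) ∼ P`. -/
def excessRisk {𝒳 𝒴 : Type*} [MeasurableSpace 𝒳] [MeasurableSpace 𝒴] (P : Measure (𝒳 × 𝒴))
    (ℓ : ℝ → 𝒴 → ℝ) (fstar f : 𝒳 → ℝ) : ℝ :=
  ∫ z, (ℓ (f z.1) z.2 - ℓ (fstar z.1) z.2) ∂P

/-- `fstar` minimizes the risk over `F`. The comparison of risks is made through the excess risk,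
which is finite for Lipschitz losses even if the risks themselves are not. -/
def IsOracle {𝒳 𝒴 : Type*} [MeasurableSpace 𝒳] [MeasurableSpace 𝒴] (P : Measure (𝒳 × 𝒴))
    (ℓ : ℝ → 𝒴 → ℝ) (F : Set (𝒳 → ℝ)) (fstar : 𝒳 → ℝ) : Prop :=
  fstar ∈ F ∧ ∀ f ∈ F, 0 ≤ excessRisk P ℓ fstar f

/-- The regularization function: nonnegative, even and convex on `E`, zero at zero, and
quasi-subadditive on `F` with constant `η`. Only the values of `φ` on `E` matter. -/
structure IsRegularizer {𝒳 : Type*} (E : Submodule ℝ (𝒳 → ℝ)) (F : Set (𝒳 → ℝ))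
    (φ : (𝒳 → ℝ) → ℝ) (η : ℝ) : Prop where
  nonneg : ∀ f ∈ E, 0 ≤ φ f
  even : ∀ f ∈ E, φ (-f) = φ f
  convex : ConvexOn ℝ (E : Set (𝒳 → ℝ)) φ
  zero : φ 0 = 0
  eta_pos : 0 < η
  quasi_add : ∀ f ∈ F, ∀ g ∈ F, φ (f + g) ≤ η * (φ f + φ g)

/-- The informative data `(X_i, Y_i)`, `i ∈ I`, are independent random variables which induce the
same `L₂` structure on `F - f*` and the same excess risk as `P`. Nothing is required for
`i ∉ I`. -/
structure IsInformative {Ω 𝒳 𝒴 : Type*} [MeasurableSpace Ω] [MeasurableSpace 𝒳]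
    [MeasurableSpace 𝒴] {N : ℕ} (Pr : Measure Ω) (P : Measure (𝒳 × 𝒴)) (ℓ : ℝ → 𝒴 → ℝ)
    (F : Set (𝒳 → ℝ)) (fstar : 𝒳 → ℝ) (X : Fin N → Ω → 𝒳) (Y : Fin N → Ω → 𝒴)
    (I : Finset (Fin N)) : Prop where
  measurable_X : ∀ i ∈ I, Measurable (X i)
  measurable_Y : ∀ i ∈ I, Measurable (Y i)
  indep : iIndepFun (fun (i : I) (ω : Ω) => (X i ω, Y i ω)) Pr
  same_L2 : ∀ i ∈ I, ∀ f ∈ F,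
    eLpNorm (fun ω => f (X i ω) - fstar (X i ω)) 2 Pr = eLpNorm (f - fstar) 2 (P.map Prod.fst)
  same_excessRisk : ∀ i ∈ I, ∀ f ∈ F,
    excessRisk (Pr.map fun ω => (X i ω, Y i ω)) ℓ fstar f = excessRisk P ℓ fstar f

/-- The localized class `{f ∈ F : ‖f - f*‖_{L₂(μ)} ≤ r, φ(f - f*) ≤ ρ}`. -/
def localClass {𝒳 : Type*} [MeasurableSpace 𝒳] (μ : Measure 𝒳) (F : Set (𝒳 → ℝ))
    (φ : (𝒳 → ℝ) → ℝ) (fstar : 𝒳 → ℝ) (ρ r : ℝ) : Set (𝒳 → ℝ) :=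
  {f | f ∈ F ∧ eLpNorm (f - fstar) 2 μ ≤ ENNReal.ofReal r ∧ φ (f - fstar) ≤ ρ}

/-- A class `G` of functions is pointwise measurable (pointwise separable) if it has a countable
subclass `T` such that each `g ∈ G` is the pointwise limit of a sequence in `T`. This is the usual
condition under which suprema over `G` are measurable. -/
def IsPointwiseMeasurable {𝒳 : Type*} (G : Set (𝒳 → ℝ)) : Prop :=
  ∃ T : Set (𝒳 → ℝ), T ⊆ G ∧ T.Countable ∧
    ∀ g ∈ G, ∃ u : ℕ → 𝒳 → ℝ, (∀ n, u n ∈ T) ∧ ∀ x, Tendsto (fun n => u n x) atTop (𝓝 (g x))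

/-- The Rademacher distribution: `±1` with probability `1/2` each. -/
def rademacher : Measure ℝ :=
  (2⁻¹ : ℝ≥0∞) • (Measure.dirac 1 + Measure.dirac (-1))

/-- `E sup_{f ∈ G} |∑_{i ∈ J} σ_i (f - f*)(X_i)|`, where `σ_1, …, σ_N` are i.i.d. Rademacher
variables independent of the data. -/
def rademacherComplexity {Ω 𝒳 : Type*} [MeasurableSpace Ω] {N : ℕ} (Pr : Measure Ω)
    (X : Fin N → Ω → 𝒳) (fstar : 𝒳 → ℝ) (G : Set (𝒳 → ℝ)) (J : Finset (Fin N)) : ℝ≥0∞ :=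
  ∫⁻ p : Ω × (Fin N → ℝ),
    (⨆ f ∈ G, ENNReal.ofReal |∑ i ∈ J, p.2 i * (f (X i p.1) - fstar (X i p.1))|)
    ∂(Pr.prod (Measure.pi fun _ : Fin N => rademacher))

/-- The radius `η (4 + 2 / A) φ(f*)` of the localization in `φ`. -/
def rhoStar {𝒳 : Type*} (φ : (𝒳 → ℝ) → ℝ) (fstar : 𝒳 → ℝ) (η A : ℝ) : ℝ :=
  η * (4 + 2 / A) * φ fstar

/-- The complexity fixed point `r̃(A)`, with the value `∞` if no radius is admissible. -/
def rTilde {Ω 𝒳 : Type*} [MeasurableSpace Ω] [MeasurableSpace 𝒳] {N : ℕ} (Pr : Measure Ω)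
    (μ : Measure 𝒳) (F : Set (𝒳 → ℝ)) (φ : (𝒳 → ℝ) → ℝ) (fstar : 𝒳 → ℝ) (X : Fin N → Ω → 𝒳)
    (I : Finset (Fin N)) (η L A : ℝ) : ℝ≥0∞ :=
  sInf (ENNReal.ofReal '' {r : ℝ | 0 < r ∧ ∀ J ⊆ I, (N : ℝ) / 2 ≤ (J.card : ℝ) →
    rademacherComplexity Pr X fstar (localClass μ F φ fstar (rhoStar φ fstar η A) r) J
      ≤ ENNReal.ofReal ((384 * A * L)⁻¹ * r ^ 2 * J.card)})

/-- `C_{S,r}(A) = max (r̃(A)², 368 A² L² S / N)`. -/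
def CSr {Ω 𝒳 : Type*} [MeasurableSpace Ω] [MeasurableSpace 𝒳] {N : ℕ} (Pr : Measure Ω)
    (μ : Measure 𝒳) (F : Set (𝒳 → ℝ)) (φ : (𝒳 → ℝ) → ℝ) (fstar : 𝒳 → ℝ) (X : Fin N → Ω → 𝒳)
    (I : Finset (Fin N)) (S : ℕ) (η L A : ℝ) : ℝ≥0∞ :=
  max (rTilde Pr μ F φ fstar X I η L A ^ 2)
    (ENNReal.ofReal (368 * A ^ 2 * L ^ 2 * ((S : ℝ) / (N : ℝ))))

/-- The local Bernstein condition with constant `A` at the squared `L₂`-radius `C` and the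
`φ`-radius `ρ`. -/
def LocalBernstein {𝒳 𝒴 : Type*} [MeasurableSpace 𝒳] [MeasurableSpace 𝒴] (P : Measure (𝒳 × 𝒴))
    (ℓ : ℝ → 𝒴 → ℝ) (F : Set (𝒳 → ℝ)) (φ : (𝒳 → ℝ) → ℝ) (fstar : 𝒳 → ℝ) (C : ℝ≥0∞)
    (ρ A : ℝ) : Prop :=
  ∀ f ∈ F, eLpNorm (f - fstar) 2 (P.map Prod.fst) = C ^ (1 / 2 : ℝ) → φ (f - fstar) ≤ ρ →
    (eLpNorm (f - fstar) 2 (P.map Prod.fst)).toReal ^ 2 ≤ A * excessRisk P ℓ fstar f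

/-- `B_1, …, B_S` is a partition of the `N` indices into blocks of equal size `N / S`. -/
structure IsBlockPartition {N S : ℕ} (B : Fin S → Finset (Fin N)) : Prop where
  disjoint : Pairwise fun s t => Disjoint (B s) (B t)
  cover : ∀ i, ∃ s, i ∈ B s
  card_eq : ∀ s, (B s).card * S = N

/-- The median of `S` real numbers: the mean of the order statistics of (zero-based) ranks
`⌊(S - 1) / 2⌋` and `⌊S / 2⌋`, that is, the middle one if `S` is odd and the mean of the two middle
ones if `S` is even. -/
def median {S : ℕ} (x : Fin S → ℝ) : ℝ :=
  if h : 0 < S then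
    (x (Tuple.sort x ⟨(S - 1) / 2, by omega⟩) + x (Tuple.sort x ⟨S / 2, by omega⟩)) / 2
  else 0

/-- `MOM_S(ℓ_f - ℓ_g)` for the sample `(x_i, y_i)` and the blocks `B`. -/
def MOM {𝒳 𝒴 : Type*} {N S : ℕ} (B : Fin S → Finset (Fin N)) (ℓ : ℝ → 𝒴 → ℝ) (x : Fin N → 𝒳)
    (y : Fin N → 𝒴) (f g : 𝒳 → ℝ) : ℝ :=
  median fun s : Fin S =>
    (1 / ((B s).card : ℝ)) * ∑ i ∈ B s, (ℓ (f (x i)) (y i) - ℓ (g (x i)) (y i))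

/-- `sup_{g ∈ F} MOM_S(ℓ_f - ℓ_g) + lam (φ(f) - φ(g))`, which may be infinite. -/
def minmaxObjective {𝒳 𝒴 : Type*} {N S : ℕ} (B : Fin S → Finset (Fin N)) (ℓ : ℝ → 𝒴 → ℝ)
    (F : Set (𝒳 → ℝ)) (φ : (𝒳 → ℝ) → ℝ) (lam : ℝ) (x : Fin N → 𝒳) (y : Fin N → 𝒴)
    (f : 𝒳 → ℝ) : EReal :=
  ⨆ g ∈ F, ((MOM B ℓ x y f g + lam * (φ f - φ g) : ℝ) : EReal)

/-- `fhat` is a regularized minmax MOM estimator: it minimizes the minmax objective over `F`. -/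
def IsMinmaxMOM {𝒳 𝒴 : Type*} {N S : ℕ} (B : Fin S → Finset (Fin N)) (ℓ : ℝ → 𝒴 → ℝ)
    (F : Set (𝒳 → ℝ)) (φ : (𝒳 → ℝ) → ℝ) (lam : ℝ) (x : Fin N → 𝒳) (y : Fin N → 𝒴)
    (fhat : 𝒳 → ℝ) : Prop :=
  fhat ∈ F ∧ ∀ f ∈ F, minmaxObjective B ℓ F φ lam x y fhat ≤ minmaxObjective B ℓ F φ lam x y f

end MinmaxMOM

end

/-! Call a block bad for `f` if its empirical excess loss falls below the excess risk by `τ =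
2r²/(3A)` or more, where `r² = C`. The theorem splits into a probabilistic half and a deterministic
half.

Probability: with probability at least `1 - exp(-S/504)`, fewer than an eighth of the informative
blocks are bad, simultaneously for all `f` in the localized class. At least `4S/7` blocks are
informative, so more than half of all blocks are good. The count of bad blocks is dominated by a sum
of clipped Lipschitz functions `ψ` of the block sums. Its means are bounded through the variance,
its expected supremum by the Rademacher complexity (symmetrization and contraction, across blocks
and then inside them), and its fluctuations by bounded differences:
`measureReal_exists_card_bad_blocks_le`. Everything is proved for a finite class, where the supremum
is `maxCoord`, and extended by monotone unions and pointwise limits.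

Determinism: any `g ∈ F` is contracted towards `fstar` into the localized class. By convexity of the
loss, lower bounds on good blocks scale back to `g` (`exists_lower_bound_blockMean`). Outside the
`L₂` ball the Bernstein condition makes the block means positive and growing with the distance;
outside the `φ` ball the penalty wins. Since more than half of the blocks obey these bounds, so do
the medians. Hence the objective at `fstar` is at most `τ + lam φ(fstar)`, and minimality of `fhat`,
tested against `g = fstar`, forces both error bounds (`minmax_bounds_of_good_blocks`). The event
does not involve `lam`, so all `lam` are covered at once. -/

noncomputable section

namespace MinmaxMOM

/-! ### Finite maxima and the two-point contraction principle -/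

section MaxCoord

variable {T : Type*} [Fintype T] [Nonempty T]

/-- The largest coordinate of a vector. -/
def maxCoord (v : T → ℝ) : ℝ := Finset.univ.sup' Finset.univ_nonempty v

lemma le_maxCoord (v : T → ℝ) (t : T) : v t ≤ maxCoord v :=
  Finset.le_sup' v (Finset.mem_univ t)

lemma maxCoord_le {v : T → ℝ} {a : ℝ} (h : ∀ t, v t ≤ a) : maxCoord v ≤ a :=
  Finset.sup'_le _ _ fun t _ => h t

lemma exists_eq_maxCoord (v : T → ℝ) : ∃ t, maxCoord v = v t := by
  obtain ⟨t, -, h⟩ := Finset.exists_mem_eq_sup' (Finset.univ_nonempty (α := T)) v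
  exact ⟨t, h⟩

lemma lipschitzWith_maxCoord : LipschitzWith 1 (maxCoord (T := T)) := by
  refine LipschitzWith.of_le_add fun v w => maxCoord_le fun t => ?_
  have h1 := le_maxCoord w t
  have h2 := (le_abs_self _).trans (norm_le_pi_norm (v - w) t)
  rw [dist_eq_norm]
  simp only [Pi.sub_apply] at h2
  linarith

lemma maxCoord_smul {a : ℝ} (ha : 0 ≤ a) (v : T → ℝ) : maxCoord (a • v) = a * maxCoord v := by
  apply le_antisymm
  · exact maxCoord_le fun t => mul_le_mul_of_nonneg_left (le_maxCoord v t) ha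
  · obtain ⟨t, ht⟩ := exists_eq_maxCoord v
    rw [ht]
    exact le_maxCoord (a • v) t

/-- With maximizers `s` of `c + b` and `t` of `c - b`, the left side is `c s + c t + (b s - b t)`.
The bound `c s + c t + |a s - a t|` is reached by testing `c + a` and `c - a` at `s, t` or at `t,
s`. Only coordinate differences enter, so no normalization at zero is required for contraction. -/
lemma maxCoord_add_add_sub_le {c a b : T → ℝ} (h : ∀ s t, |b s - b t| ≤ |a s - a t|) :
    maxCoord (c + b) + maxCoord (c - b) ≤ maxCoord (c + a) + maxCoord (c - a) := by
  obtain ⟨s, hs⟩ := exists_eq_maxCoord (c + b)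
  obtain ⟨t, ht⟩ := exists_eq_maxCoord (c - b)
  have h1 := le_maxCoord (c + a) s
  have h2 := le_maxCoord (c - a) t
  have h3 := le_maxCoord (c + a) t
  have h4 := le_maxCoord (c - a) s
  have h5 := (le_abs_self _).trans (h s t)
  rw [hs, ht]
  simp only [Pi.add_apply, Pi.sub_apply] at *
  rcases abs_cases (a s - a t) with h | h <;> linarith

end MaxCoord

/-! ### Lipschitz functionals of integrable vectors; Fubini under independence -/

section Integrals

variable {Ω : Type*} [MeasurableSpace Ω] {Pr : Measure Ω}

lemma integrable_comp_of_lipschitzWith {V : Type*} [NormedAddCommGroup V]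
    [IsFiniteMeasure Pr] {H : V → ℝ} (hH : LipschitzWith 1 H) {U : Ω → V}
    (hU : Integrable U Pr) : Integrable (fun ω => H (U ω)) Pr := by
  refine Integrable.mono' (hU.norm.add (integrable_const |H 0|))
    (hH.continuous.comp_aestronglyMeasurable hU.1) (ae_of_all _ fun ω => ?_)
  have h := hH.dist_le_mul (U ω) 0
  simp only [NNReal.coe_one, one_mul, dist_zero_right, Real.dist_eq] at h
  simp only [Pi.add_apply, Real.norm_eq_abs]
  have := abs_sub_abs_le_abs_sub (H (U ω)) (H 0)
  linarith

lemma integral_comp_prodMk_of_indepFun {V W : Type*} [MeasurableSpace V] [MeasurableSpace W]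
    [IsProbabilityMeasure Pr]
    {U : Ω → V} {R : Ω → W} (hU : Measurable U) (hR : Measurable R) (h : IndepFun U R Pr)
    {K : V × W → ℝ} (hK : Measurable K) (hint : Integrable (fun ω => K (U ω, R ω)) Pr) :
    ∫ ω, K (U ω, R ω) ∂Pr = ∫ ω, ∫ ω', K (U ω', R ω) ∂Pr ∂Pr := by
  have hUR : Measurable fun ω => (U ω, R ω) := hU.prodMk hR
  have hmap := h.map_prod_eq_prod_map_map hU.aemeasurable hR.aemeasurable
  have := Measure.isProbabilityMeasure_map (μ := Pr) hU.aemeasurable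
  have := Measure.isProbabilityMeasure_map (μ := Pr) hR.aemeasurable
  have hint' : Integrable K ((Pr.map U).prod (Pr.map R)) := by
    rw [← hmap]
    exact (integrable_map_measure hK.aestronglyMeasurable hUR.aemeasurable).2 hint
  rw [← integral_map hUR.aemeasurable (f := K) hK.aestronglyMeasurable, hmap,
    integral_prod_symm _ hint', integral_map hR.aemeasurable]
  · congr 1 with ω
    rw [integral_map hU.aemeasurable]
    exact (hK.comp measurable_prodMk_right).aestronglyMeasurable
  · exact hint'.integral_prod_right.aestronglyMeasurable

end Integrals

/-! ### Symmetrization, contraction and replacement of independent summands -/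

section Comparison

variable {T : Type*} [Fintype T] [Nonempty T] {Ω Ω' ι : Type*} [MeasurableSpace Ω]
  [MeasurableSpace Ω'] {Pr : Measure Ω} {Pr' : Measure Ω'}

/-- Symmetrization and contraction of one summand. Since `c + U - EU` is the average of `c + 2U` and
`E(c - 2U)`, Jensen's inequality for the maximum replaces centring by the two signs;
`maxCoord_add_add_sub_le` then exchanges `U` for `D`. -/
lemma integral_maxCoord_add_sub_integral_le [IsProbabilityMeasure Pr] {U D : Ω → T → ℝ}
    (hU : Integrable U Pr) (hD : Integrable D Pr)
    (h : ∀ ω s t, |U ω s - U ω t| ≤ |D ω s - D ω t|) (c : T → ℝ) :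
    ∫ ω, maxCoord (c + (U ω - fun t => ∫ ω', U ω' t ∂Pr)) ∂Pr
      ≤ 2⁻¹ * (∫ ω, maxCoord (c + (2 : ℝ) • D ω) ∂Pr + ∫ ω, maxCoord (c - (2 : ℝ) • D ω) ∂Pr) := by
  have hc : Integrable (fun _ : Ω => c) Pr := integrable_const c
  have hm : Integrable (fun _ : Ω => fun t => ∫ ω', U ω' t ∂Pr) Pr := integrable_const _
  have i1 := integrable_comp_of_lipschitzWith lipschitzWith_maxCoord (hc.add (hU.smul (2 : ℝ)))
  have i2 := integrable_comp_of_lipschitzWith lipschitzWith_maxCoord (hc.sub (hU.smul (2 : ℝ)))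
  have j1 := integrable_comp_of_lipschitzWith lipschitzWith_maxCoord (hc.add (hD.smul (2 : ℝ)))
  have j2 := integrable_comp_of_lipschitzWith lipschitzWith_maxCoord (hc.sub (hD.smul (2 : ℝ)))
  have i0 := integrable_comp_of_lipschitzWith lipschitzWith_maxCoord (hc.add (hU.sub hm))
  simp only [Pi.add_apply, Pi.sub_apply, Pi.smul_apply] at i1 i2 j1 j2 i0
  have hUt : ∀ t, Integrable (fun ω => U ω t) Pr := fun t => hU.eval t
  have key : ∀ ω, maxCoord (c + (U ω - fun t => ∫ ω', U ω' t ∂Pr))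
      ≤ 2⁻¹ * maxCoord (c + (2 : ℝ) • U ω)
        + 2⁻¹ * ∫ ω', maxCoord (c - (2 : ℝ) • U ω') ∂Pr := by
    intro ω
    refine maxCoord_le fun t => ?_
    have h1 := le_maxCoord (c + (2 : ℝ) • U ω) t
    have h2 : ∫ ω', (c t - 2 * U ω' t) ∂Pr ≤ ∫ ω', maxCoord (c - (2 : ℝ) • U ω') ∂Pr :=
      integral_mono ((integrable_const _).sub ((hUt t).const_mul 2)) i2
        fun ω' => le_maxCoord (c - (2 : ℝ) • U ω') t
    rw [integral_sub (integrable_const _) ((hUt t).const_mul 2), integral_const_mul,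
      integral_const] at h2
    simp only [Pi.add_apply, Pi.sub_apply, Pi.smul_apply, smul_eq_mul, probReal_univ, one_mul]
      at h1 h2 ⊢
    linarith
  have step1 : ∫ ω, maxCoord (c + (U ω - fun t => ∫ ω', U ω' t ∂Pr)) ∂Pr
      ≤ 2⁻¹ * (∫ ω, maxCoord (c + (2 : ℝ) • U ω) ∂Pr
        + ∫ ω, maxCoord (c - (2 : ℝ) • U ω) ∂Pr) := by
    refine (integral_mono i0 ((i1.const_mul _).add (integrable_const _)) key).trans_eq ?_
    simp only [Pi.add_apply]
    rw [integral_add (i1.const_mul _) (integrable_const _), integral_const_mul, integral_const]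
    simp only [probReal_univ, one_smul]
    ring
  refine step1.trans (mul_le_mul_of_nonneg_left ?_ (by norm_num))
  rw [← integral_add i1 i2, ← integral_add j1 j2]
  refine integral_mono (i1.add i2) (j1.add j2) fun ω => maxCoord_add_add_sub_le fun s t => ?_
  simp only [Pi.smul_apply, smul_eq_mul, ← mul_sub, abs_mul]
  exact mul_le_mul_of_nonneg_left (h ω s t) (abs_nonneg _)

/-- Independent summands may be replaced one at a time: a comparison of all the expectations
`E max (c + U i)` is inherited by the sums. -/
theorem integral_maxCoord_add_sum_le [IsProbabilityMeasure Pr] [IsProbabilityMeasure Pr']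
    [DecidableEq ι] {U : ι → Ω → T → ℝ} {U' : ι → Ω' → T → ℝ} (s : Finset ι)
    (hm : ∀ i ∈ s, Measurable (U i)) (hm' : ∀ i ∈ s, Measurable (U' i))
    (hi : ∀ i ∈ s, Integrable (U i) Pr) (hi' : ∀ i ∈ s, Integrable (U' i) Pr')
    (hind : ∀ i ∈ s, ∀ t ⊆ s, i ∉ t → IndepFun (U i) (fun ω => ∑ j ∈ t, U j ω) Pr)
    (hind' : ∀ i ∈ s, ∀ t ⊆ s, i ∉ t → IndepFun (U' i) (fun ω => ∑ j ∈ t, U' j ω) Pr')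
    (h : ∀ i ∈ s, ∀ c, ∫ ω, maxCoord (c + U i ω) ∂Pr ≤ ∫ ω, maxCoord (c + U' i ω) ∂Pr')
    (c : T → ℝ) :
    ∫ ω, maxCoord (c + ∑ i ∈ s, U i ω) ∂Pr ≤ ∫ ω, maxCoord (c + ∑ i ∈ s, U' i ω) ∂Pr' := by
  induction s using Finset.induction_on generalizing c with
  | empty => simp
  | insert a s ha ih =>
    have hsub : s ⊆ insert a s := Finset.subset_insert a s
    have hmem : ∀ i ∈ s, i ∈ insert a s := fun i hi => hsub hi
    have haa : a ∈ insert a s := Finset.mem_insert_self a s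
    have ih := ih (fun i h => hm i (hmem i h)) (fun i h => hm' i (hmem i h))
      (fun i h => hi i (hmem i h)) (fun i h => hi' i (hmem i h))
      (fun i hi t ht => hind i (hmem i hi) t (ht.trans hsub))
      (fun i hi t ht => hind' i (hmem i hi) t (ht.trans hsub)) (fun i hi => h i (hmem i hi))
    have mS : Measurable fun ω => ∑ i ∈ s, U i ω :=
      Finset.measurable_fun_sum s fun i h => hm i (hmem i h)
    have mS' : Measurable fun ω => ∑ i ∈ s, U' i ω :=
      Finset.measurable_fun_sum s fun i h => hm' i (hmem i h)
    have iS : Integrable (fun ω => ∑ i ∈ s, U i ω) Pr :=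
      integrable_finsetSum s fun i h => hi i (hmem i h)
    have iS' : Integrable (fun ω => ∑ i ∈ s, U' i ω) Pr' :=
      integrable_finsetSum s fun i h => hi' i (hmem i h)
    have hK : Measurable fun p : (T → ℝ) × (T → ℝ) => maxCoord (c + (p.1 + p.2)) :=
      (lipschitzWith_maxCoord.continuous.comp (by fun_prop)).measurable
    have hcc : Integrable (fun _ : Ω => c) Pr := integrable_const c
    have hcc' : Integrable (fun _ : Ω' => c) Pr' := integrable_const c
    have e1 := integral_comp_prodMk_of_indepFun (hm a haa) mS (hind a haa s hsub ha) hK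
      (integrable_comp_of_lipschitzWith lipschitzWith_maxCoord
        (hcc.add ((hi a haa).add iS)))
    have e2 := integral_comp_prodMk_of_indepFun (hm' a haa) mS' (hind' a haa s hsub ha) hK
      (integrable_comp_of_lipschitzWith lipschitzWith_maxCoord
        (hcc'.add ((hi' a haa).add iS')))
    have iP : Integrable (fun p : Ω × Ω' => maxCoord (c + (U' a p.2 + ∑ i ∈ s, U i p.1)))
        (Pr.prod Pr') :=
      integrable_comp_of_lipschitzWith lipschitzWith_maxCoord
        ((integrable_const c).add (((hi' a haa).comp_snd Pr).add (iS.comp_fst Pr')))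
    have iQ : Integrable (fun p : Ω' × Ω' => maxCoord (c + (U' a p.2 + ∑ i ∈ s, U' i p.1)))
        (Pr'.prod Pr') :=
      integrable_comp_of_lipschitzWith lipschitzWith_maxCoord
        ((integrable_const c).add (((hi' a haa).comp_snd Pr').add (iS'.comp_fst Pr')))
    have iR : Integrable (fun p : Ω × Ω => maxCoord (c + (U a p.2 + ∑ i ∈ s, U i p.1)))
        (Pr.prod Pr) :=
      integrable_comp_of_lipschitzWith lipschitzWith_maxCoord
        ((integrable_const c).add (((hi a haa).comp_snd Pr).add (iS.comp_fst Pr)))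
    have eS : ∫ ω, ∫ ω', maxCoord (c + (U' a ω' + ∑ i ∈ s, U' i ω)) ∂Pr' ∂Pr'
        = ∫ ω', ∫ ω, maxCoord (c + (U' a ω' + ∑ i ∈ s, U' i ω)) ∂Pr' ∂Pr' :=
      integral_integral_swap (f := fun ω ω' => maxCoord (c + (U' a ω' + ∑ i ∈ s, U' i ω))) iQ
    simp only [Finset.sum_insert ha]
    rw [e1, e2, eS]
    -- The summand `a` is replaced with the other sum frozen and absorbed into `c`; after a swap of
    -- integrals the induction hypothesis applies with `U' a` frozen. This is why `c` is arbitrary.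
    calc ∫ ω, ∫ ω', maxCoord (c + (U a ω' + ∑ i ∈ s, U i ω)) ∂Pr ∂Pr
        ≤ ∫ ω, ∫ ω', maxCoord (c + (U' a ω' + ∑ i ∈ s, U i ω)) ∂Pr' ∂Pr := by
          refine integral_mono iR.integral_prod_left iP.integral_prod_left fun ω => ?_
          have := h a haa (c + ∑ i ∈ s, U i ω)
          simpa only [add_assoc, add_comm (∑ i ∈ s, U i ω)] using this
      _ = ∫ ω', ∫ ω, maxCoord (c + (U' a ω' + ∑ i ∈ s, U i ω)) ∂Pr ∂Pr' :=
          integral_integral_swap (f := fun ω ω' => maxCoord (c + (U' a ω' + ∑ i ∈ s, U i ω))) iP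
      _ ≤ ∫ ω', ∫ ω, maxCoord (c + (U' a ω' + ∑ i ∈ s, U' i ω)) ∂Pr' ∂Pr' := by
          refine integral_mono iP.integral_prod_right iQ.integral_prod_right fun ω' => ?_
          have := ih (c + U' a ω')
          simpa only [add_assoc] using this

end Comparison

/-! ### Bounded differences -/

section BoundedDifferences

variable {T : Type*} [Fintype T] {Ω ι : Type*} [MeasurableSpace Ω] {Pr : Measure Ω}

/-- Bounded differences inequality for Lipschitz functions of sums of independent vectors bounded
by `1 / 2` in supremum norm. -/
theorem hasSubgaussianMGF_lipschitz_sum [IsProbabilityMeasure Pr] [DecidableEq ι]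
    {U : ι → Ω → T → ℝ} (s : Finset ι) (hm : ∀ i ∈ s, Measurable (U i))
    (hb : ∀ i ∈ s, ∀ ω, ‖U i ω‖ ≤ 1 / 2)
    (hind : ∀ i ∈ s, ∀ t ⊆ s, i ∉ t → IndepFun (U i) (fun ω => ∑ j ∈ t, U j ω) Pr)
    (H : (T → ℝ) → ℝ) (hH : LipschitzWith 1 H) :
    HasSubgaussianMGF (fun ω => H (∑ i ∈ s, U i ω) - ∫ ω', H (∑ i ∈ s, U i ω') ∂Pr)
      ((s.card : NNReal) / 4) Pr := by
  induction s using Finset.induction_on generalizing H with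
  | empty => simp
  | insert a s ha ih =>
    have hsub : s ⊆ insert a s := Finset.subset_insert a s
    have hmem : ∀ i ∈ s, i ∈ insert a s := fun i hi => hsub hi
    have haa : a ∈ insert a s := Finset.mem_insert_self a s
    have ih := ih (fun i h => hm i (hmem i h)) (fun i h => hb i (hmem i h))
      (fun i hi t ht => hind i (hmem i hi) t (ht.trans hsub))
    have mS : Measurable fun ω => ∑ i ∈ s, U i ω :=
      Finset.measurable_fun_sum s fun i h => hm i (hmem i h)
    have hi : ∀ i ∈ insert a s, Integrable (U i) Pr := fun i h =>
      Integrable.of_bound (hm i h).aestronglyMeasurable (1 / 2) (ae_of_all _ (hb i h))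
    have iS : Integrable (fun ω => ∑ i ∈ s, U i ω) Pr :=
      integrable_finsetSum s fun i h => hi i (hmem i h)
    have iv : ∀ v, Integrable (fun ω => H (U a ω + v)) Pr := fun v =>
      integrable_comp_of_lipschitzWith hH ((hi a haa).add (integrable_const v))
    -- Averaging out one summand keeps the function 1-Lipschitz, so the induction hypothesis applies
    -- to `g`.
    set g : (T → ℝ) → ℝ := fun v => ∫ ω, H (U a ω + v) ∂Pr with hg
    have gL : LipschitzWith 1 g := by
      refine LipschitzWith.of_le_add fun v w => ?_
      have : ∫ ω, H (U a ω + v) ∂Pr ≤ ∫ ω, (H (U a ω + w) + dist v w) ∂Pr := by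
        refine integral_mono (iv v) ((iv w).add (integrable_const _)) fun ω => ?_
        have := (le_abs_self _).trans (hH.dist_le_mul (U a ω + v) (U a ω + w))
        rw [dist_add_left] at this
        simp only [NNReal.coe_one, one_mul] at this
        simp only
        linarith
      rwa [integral_add (iv w) (integrable_const _), integral_const, probReal_univ, one_smul]
        at this
    have ihg := ih g gL
    have hK1 : Measurable fun p : (T → ℝ) × (T → ℝ) => H (p.1 + p.2) :=
      (hH.continuous.comp (by fun_prop)).measurable
    have hint : Integrable (fun ω => H (U a ω + ∑ i ∈ s, U i ω)) Pr :=
      integrable_comp_of_lipschitzWith hH ((hi a haa).add iS)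
    have e1 : ∫ ω, H (U a ω + ∑ i ∈ s, U i ω) ∂Pr = ∫ ω, g (∑ i ∈ s, U i ω) ∂Pr :=
      integral_comp_prodMk_of_indepFun (hm a haa) mS (hind a haa s hsub ha) hK1 hint
    -- For fixed `v` the value stays within `1 / 2` of `H v`, an interval of length 1: Hoeffding's
    -- lemma gives the proxy `1 / 4`, and each summand contributes one such term.
    have hoeff : ∀ v, HasSubgaussianMGF (fun ω => H (U a ω + v) - g v) (4⁻¹) Pr := by
      intro v
      have := hasSubgaussianMGF_of_mem_Icc (μ := Pr) (X := fun ω => H (U a ω + v))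
        (a := H v - 1 / 2) (b := H v + 1 / 2) (iv v).1.aemeasurable (ae_of_all _ fun ω => by
          have h := hH.dist_le_mul (U a ω + v) v
          rw [dist_eq_norm (U a ω + v), add_sub_cancel_right, Real.dist_eq] at h
          have h' := abs_le.1 (h.trans (by simpa using hb a haa ω))
          constructor <;> linarith [h'.1, h'.2])
      convert this using 1
      rw [show H v + 1 / 2 - (H v - 1 / 2) = 1 by ring, nnnorm_one]
      norm_num [div_pow]
    have hbd : ∃ M, ∀ ω, |H (U a ω + ∑ i ∈ s, U i ω)| ≤ M := by
      refine ⟨|H 0| + (1 / 2 + ∑ i ∈ s, 1 / 2), fun ω => ?_⟩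
      have h := hH.dist_le_mul (U a ω + ∑ i ∈ s, U i ω) 0
      simp only [NNReal.coe_one, one_mul, dist_zero_right, Real.dist_eq] at h
      have h2 := abs_sub_abs_le_abs_sub (H (U a ω + ∑ i ∈ s, U i ω)) (H 0)
      have h3 : ‖U a ω + ∑ i ∈ s, U i ω‖ ≤ 1 / 2 + ∑ i ∈ s, 1 / 2 :=
        (norm_add_le _ _).trans (add_le_add (hb a haa ω)
          ((norm_sum_le _ _).trans (Finset.sum_le_sum fun i h => hb i (hmem i h) ω)))
      linarith
    obtain ⟨M, hM⟩ := hbd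
    simp only [Finset.sum_insert ha]
    rw [e1]
    set m := ∫ ω, g (∑ i ∈ s, U i ω) ∂Pr with hmdef
    have hexp : ∀ t : ℝ, Integrable
        (fun ω => Real.exp (t * (H (U a ω + ∑ i ∈ s, U i ω) - m))) Pr := by
      intro t
      refine integrable_exp_mul_of_mem_Icc (a := -M - m) (b := M - m)
        (hint.1.aemeasurable.sub_const m) (ae_of_all _ fun ω => ?_)
      have := abs_le.1 (hM ω)
      constructor <;> linarith [this.1, this.2]
    refine ⟨hexp, fun t => ?_⟩
    have hK : Measurable fun p : (T → ℝ) × (T → ℝ) => Real.exp (t * (H (p.1 + p.2) - m)) :=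
      ((hK1.sub_const m).const_mul t).exp
    have e2 := integral_comp_prodMk_of_indepFun (hm a haa) mS (hind a haa s hsub ha) hK (hexp t)
    have inner : ∀ v, ∫ ω, Real.exp (t * (H (U a ω + v) - m)) ∂Pr
        ≤ Real.exp (4⁻¹ * t ^ 2 / 2) * Real.exp (t * (g v - m)) := by
      intro v
      have h1 := (hoeff v).mgf_le t
      have h2 : ∀ ω, Real.exp (t * (H (U a ω + v) - m))
          = Real.exp (t * (H (U a ω + v) - g v)) * Real.exp (t * (g v - m)) := fun ω => by
        rw [← Real.exp_add]; ring_nf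
      simp only [h2, integral_mul_const]
      refine mul_le_mul_of_nonneg_right ?_ (Real.exp_pos _).le
      simpa [mgf] using h1
    calc mgf (fun ω => H (U a ω + ∑ i ∈ s, U i ω) - m) Pr t
        = ∫ ω, ∫ ω', Real.exp (t * (H (U a ω' + ∑ i ∈ s, U i ω) - m)) ∂Pr ∂Pr := e2
      _ ≤ ∫ ω, Real.exp (4⁻¹ * t ^ 2 / 2) * Real.exp (t * (g (∑ i ∈ s, U i ω) - m)) ∂Pr :=
          integral_mono_of_nonneg (ae_of_all _ fun ω => integral_nonneg fun _ => (Real.exp_pos _).le)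
            ((ihg.integrable_exp_mul t).const_mul _) (ae_of_all _ fun ω => inner _)
      _ ≤ Real.exp (4⁻¹ * t ^ 2 / 2) * Real.exp (((s.card : NNReal) / 4 : NNReal) * t ^ 2 / 2) := by
          rw [integral_const_mul]
          exact mul_le_mul_of_nonneg_left (ihg.mgf_le t) (Real.exp_pos _).le
      _ = _ := by
          rw [← Real.exp_add, Finset.card_insert_of_notMem ha]
          congr 1
          push_cast
          ring

end BoundedDifferences

/-! ### Independence on products and of group sums -/

section Independence

variable {Ω Ω' ι κ : Type*} [MeasurableSpace Ω] [MeasurableSpace Ω'] {Pr : Measure Ω}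
  {ν : Measure Ω'}

lemma iIndepFun_prodMk_prod [Fintype ι] [IsProbabilityMeasure Pr] [IsProbabilityMeasure ν]
    {V W : Type*} [MeasurableSpace V] [MeasurableSpace W] {h : ι → Ω → V} {σ : ι → Ω' → W}
    (hh : ∀ i, Measurable (h i)) (hσ : ∀ i, Measurable (σ i))
    (ih : iIndepFun h Pr) (iσ : iIndepFun σ ν) :
    iIndepFun (fun i (p : Ω × Ω') => (h i p.1, σ i p.2)) (Pr.prod ν) := by
  have := fun i => Measure.isProbabilityMeasure_map (μ := Pr) (hh i).aemeasurable
  have := fun i => Measure.isProbabilityMeasure_map (μ := ν) (hσ i).aemeasurable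
  have mh : Measurable fun ω i => h i ω := measurable_pi_lambda _ hh
  have mσ : Measurable fun ω i => σ i ω := measurable_pi_lambda _ hσ
  have mp : ∀ i, Measurable fun p : Ω × Ω' => (h i p.1, σ i p.2) := fun i =>
    ((hh i).comp measurable_fst).prodMk ((hσ i).comp measurable_snd)
  rw [iIndepFun_iff_map_fun_eq_pi_map fun i => (mp i).aemeasurable]
  have h1 : ∀ i, (Pr.prod ν).map (fun p => (h i p.1, σ i p.2))
      = (Pr.map (h i)).prod (ν.map (σ i)) := fun i =>
    (Measure.map_prod_map Pr ν (hh i) (hσ i)).symm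
  have h2 := Measure.map_prod_map Pr ν mh mσ
  rw [ih.map_fun_eq_pi_map fun i => (hh i).aemeasurable,
    iσ.map_fun_eq_pi_map fun i => (hσ i).aemeasurable] at h2
  have h3 := (measurePreserving_arrowProdEquivProdArrow V W ι (fun i => Pr.map (h i))
    (fun i => ν.map (σ i))).symm.map_eq
  simp only [h1]
  rw [← h3, h2, Measure.map_map (MeasurableEquiv.measurable _) (by fun_prop)]
  rfl

/-- Functions of sums over disjoint groups of independent variables are independent. -/
lemma indepFun_sum_groups [IsProbabilityMeasure Pr] [DecidableEq ι] {V : Type*}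
    [MeasurableSpace V] [AddCommMonoid V] [MeasurableAdd₂ V] {Y : ι → Ω → V}
    (hY : ∀ i, Measurable (Y i)) (iY : iIndepFun Y Pr) {b : κ → Finset ι}
    {Ψ : κ → V → V} (hΨ : ∀ s, Measurable (Ψ s)) (s : κ) (t : Finset κ)
    (hd : ∀ r ∈ t, Disjoint (b s) (b r)) :
    IndepFun (fun ω => Ψ s (∑ i ∈ b s, Y i ω))
      (fun ω => ∑ r ∈ t, Ψ r (∑ i ∈ b r, Y i ω)) Pr := by
  have h := iY.indepFun_finset (b s) (t.biUnion b)
    ((Finset.disjoint_biUnion_right _ _ _).2 hd) hY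
  have m1 : Measurable fun y : b s → V => Ψ s (∑ i, y i) :=
    (hΨ s).comp (Finset.measurable_fun_sum _ fun i _ => measurable_pi_apply i)
  have m2 : Measurable fun y : t.biUnion b → V =>
      ∑ r ∈ t.attach, Ψ r (∑ i : b r, y ⟨i, Finset.mem_biUnion.2 ⟨r, r.2, i.2⟩⟩) :=
    Finset.measurable_fun_sum _ fun r _ =>
      (hΨ r).comp (Finset.measurable_fun_sum _ fun i _ => measurable_pi_apply _)
  convert h.comp m1 m2 using 1
  · ext ω
    simp only [Function.comp_apply]
    rw [Finset.sum_coe_sort (b s) fun i => Y i ω]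
  · ext ω
    simp only [Function.comp_apply]
    rw [← Finset.sum_attach]
    refine Finset.sum_congr rfl fun r _ => ?_
    rw [Finset.sum_coe_sort (b r) fun i => Y i ω]

end Independence

/-! ### Rademacher signs -/

section Signs

instance isProbabilityMeasure_rademacher : IsProbabilityMeasure rademacher := by
  constructor
  simp only [rademacher, Measure.smul_apply, Measure.add_apply, measure_univ, smul_eq_mul]
  rw [one_add_one_eq_two]
  exact ENNReal.inv_mul_cancel (by norm_num) (by norm_num)

lemma integral_rademacher (f : ℝ → ℝ) : ∫ x, f x ∂rademacher = 2⁻¹ * (f 1 + f (-1)) := by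
  rw [rademacher, integral_smul_measure, integral_add_measure, integral_dirac, integral_dirac]
  · simp
  · exact integrable_dirac (by simp)
  · exact integrable_dirac (by simp)

lemma ae_abs_eq_one_rademacher : ∀ᵐ x ∂rademacher, |x| = 1 := by
  rw [rademacher, ae_iff]
  simp

variable {T : Type*} [Fintype T] {Ω Ω' : Type*} [MeasurableSpace Ω]
  [MeasurableSpace Ω'] {Pr : Measure Ω} {ν : Measure Ω'}

lemma integrable_sign_smul [IsProbabilityMeasure Pr] [IsProbabilityMeasure ν]
    {σ : Ω' → ℝ} (hσ : Measurable σ) (hlaw : ν.map σ = rademacher) {D : Ω → T → ℝ}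
    (hm : Measurable D) (hD : Integrable D Pr) :
    Integrable (fun p : Ω × Ω' => σ p.2 • D p.1) (Pr.prod ν) := by
  refine Integrable.mono (hD.comp_fst ν) ?_ ?_
  · exact (Measurable.smul (hσ.comp measurable_snd) (hm.comp measurable_fst)).aestronglyMeasurable
  · have h1 : ∀ᵐ y ∂ν, |σ y| = 1 := by
      have := ae_abs_eq_one_rademacher
      rw [← hlaw] at this
      exact ae_of_ae_map hσ.aemeasurable this
    have h2 : ∀ᵐ p ∂(Pr.prod ν), |σ p.2| = 1 :=
      Measure.quasiMeasurePreserving_snd.ae h1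
    filter_upwards [h2] with p hp
    rw [norm_smul, Real.norm_eq_abs, hp, one_mul]

lemma integral_maxCoord_add_sign_smul [Nonempty T] [IsProbabilityMeasure Pr] [IsProbabilityMeasure ν]
    {σ : Ω' → ℝ} (hσ : Measurable σ) (hlaw : ν.map σ = rademacher) {D : Ω → T → ℝ}
    (hm : Measurable D) (hD : Integrable D Pr) (c : T → ℝ) :
    ∫ p, maxCoord (c + σ p.2 • D p.1) ∂(Pr.prod ν)
      = 2⁻¹ * (∫ ω, maxCoord (c + D ω) ∂Pr + ∫ ω, maxCoord (c - D ω) ∂Pr) := by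
  have hint : Integrable (fun p : Ω × Ω' => maxCoord (c + σ p.2 • D p.1)) (Pr.prod ν) :=
    integrable_comp_of_lipschitzWith lipschitzWith_maxCoord
      ((integrable_const c).add (integrable_sign_smul hσ hlaw hm hD))
  have hmeas : StronglyMeasurable fun x : ℝ => ∫ ω, maxCoord (c + x • D ω) ∂Pr := by
    have : Measurable (Function.uncurry fun (x : ℝ) (ω : Ω) => maxCoord (c + x • D ω)) :=
      lipschitzWith_maxCoord.continuous.measurable.comp
        (measurable_const.add (measurable_fst.smul (hm.comp measurable_snd)))
    exact this.stronglyMeasurable.integral_prod_right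
  rw [integral_prod_symm _ hint,
    ← integral_map hσ.aemeasurable (f := fun x : ℝ => ∫ ω, maxCoord (c + x • D ω) ∂Pr)
      hmeas.aestronglyMeasurable, hlaw, integral_rademacher]
  simp [sub_eq_add_neg]

end Signs

/-! ### Uniform control of the number of bad blocks -/

section Blocks

variable {T : Type*} [Fintype T] [Nonempty T] {Ω Ω' ι κ : Type*} [MeasurableSpace Ω]
  [MeasurableSpace Ω'] {Pr : Measure Ω} {ν : Measure Ω'} [Fintype ι]

/-- Symmetrization and contraction, first for the blocks and then within each block. -/
theorem integral_maxCoord_block_sum_le [IsProbabilityMeasure Pr] [IsProbabilityMeasure ν]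
    {g h : ι → Ω → T → ℝ} {σ : ι → Ω' → ℝ} {L a : ℝ} {ψ : ℝ → ℝ}
    (hgm : ∀ i, Measurable (g i)) (hhm : ∀ i, Measurable (h i)) (hσm : ∀ i, Measurable (σ i))
    (hgi : ∀ i, Integrable (g i) Pr) (hhi : ∀ i, Integrable (h i) Pr)
    (hlaw : ∀ i, ν.map (σ i) = rademacher)
    (ig : iIndepFun g Pr) (ih : iIndepFun h Pr) (iσ : iIndepFun σ ν)
    (hL : ∀ i ω s t, |g i ω s - g i ω t| ≤ L * |h i ω s - h i ω t|) (hL0 : 0 ≤ L)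
    (hψ : ∀ x y, |ψ x - ψ y| ≤ a * |x - y|) (ha : 0 ≤ a)
    (K : Finset κ) (b : κ → Finset ι) (hb : ∀ s ∈ K, ∀ r ∈ K, s ≠ r → Disjoint (b s) (b r))
    {W : κ → Ω → T → ℝ} (hW : ∀ s ω t, W s ω t = ∑ i ∈ b s, (g i ω t - ∫ ω', g i ω' t ∂Pr)) :
    ∫ ω, maxCoord (∑ s ∈ K, fun t => ψ (W s ω t) - ∫ ω', ψ (W s ω' t) ∂Pr) ∂Pr
      ≤ ∫ p, maxCoord (∑ s ∈ K, ∑ i ∈ b s, σ i p.2 • (4 * a * L) • h i p.1) ∂(Pr.prod ν) := by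
  classical
  set m : ι → T → ℝ := fun i t => ∫ ω, g i ω t ∂Pr with hm
  set Y : ι → Ω → T → ℝ := fun i ω => g i ω - m i with hY
  have hYm : ∀ i, Measurable (Y i) := fun i => (hgm i).sub_const (m i)
  have hYi : ∀ i, Integrable (Y i) Pr := fun i => (hgi i).sub (integrable_const (m i))
  have iY : iIndepFun Y Pr := ig.comp (fun i v => v - m i) fun i => measurable_id.sub_const (m i)
  have hWY : ∀ s ω, W s ω = ∑ i ∈ b s, Y i ω := fun s ω => by
    ext t
    simp [hW, hY, hm]
  have hWm : ∀ s, Measurable (W s) := fun s => by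
    rw [show W s = fun ω => ∑ i ∈ b s, Y i ω from funext (hWY s)]
    exact Finset.measurable_fun_sum _ fun i _ => hYm i
  have hWi : ∀ s, Integrable (W s) Pr := fun s => by
    rw [show W s = fun ω => ∑ i ∈ b s, Y i ω from funext (hWY s)]
    exact integrable_finsetSum _ fun i _ => hYi i
  have hψL : LipschitzWith a.toNNReal ψ := LipschitzWith.of_dist_le_mul fun x y => by
    rw [Real.coe_toNNReal a ha]
    exact hψ x y
  have hψm : Measurable ψ := hψL.continuous.measurable
  set R : ι → Ω × Ω' → T → ℝ := fun i p => σ i p.2 • (4 * a * L) • h i p.1 with hR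
  have hRm : ∀ i, Measurable (R i) := fun i =>
    ((hσm i).comp measurable_snd).smul (((hhm i).const_smul (4 * a * L)).comp measurable_fst)
  have hRi : ∀ i, Integrable (R i) (Pr.prod ν) := fun i =>
    integrable_sign_smul (hσm i) (hlaw i) ((hhm i).const_smul _) ((hhi i).smul (4 * a * L))
  have iR : iIndepFun R (Pr.prod ν) :=
    (iIndepFun_prodMk_prod hhm hσm ih iσ).comp (fun _ q => q.2 • (4 * a * L) • q.1)
      fun _ => measurable_snd.smul (measurable_fst.const_smul (4 * a * L))
  -- Within a block: the summands of `W s` are centred, so each is symmetrized and contracted at the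
  -- cost of a factor `2 * L`, whence `4 * a * L`. The bound is the same for both signs of `θ`, so
  -- the sign attached to a block by the outer symmetrization disappears.
  have inner : ∀ θ : ℝ, |θ| = 2 * a → ∀ s c, ∫ ω, maxCoord (c + θ • W s ω) ∂Pr
      ≤ ∫ p, maxCoord (c + ∑ i ∈ b s, R i p) ∂(Pr.prod ν) := by
    intro θ hθ s c
    have iθ : iIndepFun (fun i ω => θ • Y i ω) Pr :=
      iY.comp (fun _ v => θ • v) fun _ => measurable_id.const_smul θ
    simp only [hWY, Finset.smul_sum]
    refine integral_maxCoord_add_sum_le (U := fun i ω => θ • Y i ω) (b s)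
      (fun i _ => (hYm i).const_smul θ) (fun i _ => hRm i) (fun i _ => (hYi i).smul θ)
      (fun i _ => hRi i) (fun i _ t _ hit => ?_) (fun i _ t _ hit => ?_) (fun i _ c => ?_) c
    · have := (iθ.indepFun_finsetSum_of_notMem (fun i => (hYm i).const_smul θ) hit).symm
      convert this using 1
      ext ω : 1
      simp
    · have := (iR.indepFun_finsetSum_of_notMem hRm hit).symm
      convert this using 1
      ext ω : 1
      simp
    · have h1 := integral_maxCoord_add_sub_integral_le (Pr := Pr) (U := fun ω => θ • g i ω)
        (D := fun ω => (2 * a * L) • h i ω) ((hgi i).smul θ) ((hhi i).smul (2 * a * L)) (fun ω s t => by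
          simp only [Pi.smul_apply, smul_eq_mul, ← mul_sub, abs_mul, hθ, abs_of_nonneg ha,
            abs_of_nonneg hL0, Nat.abs_ofNat]
          rw [mul_assoc (2 * a)]
          exact mul_le_mul_of_nonneg_left (hL i ω s t) (by positivity)) c
      have h2 := integral_maxCoord_add_sign_smul (hσm i) (hlaw i)
        ((hhm i).const_smul (4 * a * L)) ((hhi i).smul (4 * a * L)) c
      simp only [Pi.smul_apply] at h2
      rw [h2]
      refine (le_of_eq ?_).trans (h1.trans_eq ?_)
      · congr 1 with ω
        congr 2
        ext t
        simp only [hY, hm, Pi.smul_apply, Pi.sub_apply, smul_eq_mul, integral_const_mul]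
        ring
      · simp only [smul_smul]
        ring_nf
  set M : κ → T → ℝ := fun s t => ∫ ω', ψ (W s ω' t) ∂Pr with hM
  have hψW : ∀ s, Integrable (fun ω t => ψ (W s ω t)) Pr := fun s => by
    refine Integrable.of_eval fun t => ?_
    refine Integrable.mono' (((hWi s).eval t).norm.const_mul a |>.add (integrable_const |ψ 0|))
      (hψm.comp ((measurable_pi_apply t).comp (hWm s))).aestronglyMeasurable
      (ae_of_all _ fun ω => ?_)
    have h1 := hψ (W s ω t) 0
    have h2 := abs_sub_abs_le_abs_sub (ψ (W s ω t)) (ψ 0)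
    simp only [sub_zero] at h1
    simp only [Pi.add_apply, Real.norm_eq_abs]
    linarith
  have hΨ : ∀ s, Measurable fun (v : T → ℝ) t => ψ (v t) - M s t := fun s =>
    measurable_pi_lambda _ fun t => (hψm.comp (measurable_pi_apply t)).sub_const _
  have outer := integral_maxCoord_add_sum_le (Pr := Pr) (Pr' := Pr.prod ν)
    (U := fun s ω t => ψ (W s ω t) - M s t) (U' := fun s p => ∑ i ∈ b s, R i p) K
    (fun s _ => (hΨ s).comp (hWm s)) (fun s _ => Finset.measurable_fun_sum _ fun i _ => hRm i)
    (fun s _ => (hψW s).sub (integrable_const (M s)))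
    (fun s _ => integrable_finsetSum _ fun i _ => hRi i)
    (fun s hs t ht hst => by
      have := indepFun_sum_groups hYm iY hΨ s t
        fun r hr => hb s hs r (ht hr) fun e => hst (e ▸ hr)
      simpa only [← hWY] using this)
    (fun s hs t ht hst => by
      exact indepFun_sum_groups hRm iR (Ψ := fun _ v => v) (fun _ => measurable_id) s t
        fun r hr => hb s hs r (ht hr) fun e => hst (e ▸ hr))
    (fun s hs c => by
      have h1 := integral_maxCoord_add_sub_integral_le (Pr := Pr) (U := fun ω t => ψ (W s ω t))
        (D := fun ω => a • W s ω) (hψW s) ((hWi s).smul a) (fun ω s t => by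
          simp only [Pi.smul_apply, smul_eq_mul, ← mul_sub, abs_mul, abs_of_nonneg ha]
          exact hψ _ _) c
      have h2 := inner (2 * a) (abs_of_nonneg (by positivity)) s c
      have h3 := inner (-(2 * a)) (by rw [abs_neg]; exact abs_of_nonneg (by positivity)) s c
      simp only [neg_smul, ← sub_eq_add_neg] at h3
      simp only [smul_smul] at h1
      refine le_trans (le_of_eq rfl) (h1.trans ?_)
      linarith) 0
  simpa only [zero_add] using outer

lemma abs_clip_sub_clip_le (x y : ℝ) : |max 0 (min 1 x) - max 0 (min 1 y)| ≤ |x - y| := by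
  have h1 := abs_max_sub_max_le_max 0 (min 1 x) 0 (min 1 y)
  have h2 := abs_min_sub_min_le_max 1 x 1 y
  simp only [sub_self, abs_zero, abs_nonneg, sup_of_le_right] at h1 h2
  exact h1.trans h2

/-- Uniform control of the number of blocks with a large negative deviation. -/
theorem measureReal_exists_card_bad_blocks_le [IsProbabilityMeasure Pr] [IsProbabilityMeasure ν]
    {g h : ι → Ω → T → ℝ} {σ : ι → Ω' → ℝ} {L τ v : ℝ} {n : ℕ}
    (hgm : ∀ i, Measurable (g i)) (hhm : ∀ i, Measurable (h i)) (hσm : ∀ i, Measurable (σ i))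
    (hg2 : ∀ i t, MemLp (fun ω => g i ω t) 2 Pr) (hhi : ∀ i, Integrable (h i) Pr)
    (hlaw : ∀ i, ν.map (σ i) = rademacher)
    (ig : iIndepFun g Pr) (ih : iIndepFun h Pr) (iσ : iIndepFun σ ν)
    (hL : ∀ i ω s t, |g i ω s - g i ω t| ≤ L * |h i ω s - h i ω t|) (hL0 : 0 ≤ L)
    (hτ : 0 < τ) (hn : 0 < n)
    (K : Finset κ) (b : κ → Finset ι) (hb : ∀ s ∈ K, ∀ r ∈ K, s ≠ r → Disjoint (b s) (b r))
    (hcard : ∀ s ∈ K, (b s).card = n)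
    (hvar : ∀ i t, variance (fun ω => g i ω t) Pr ≤ v) (hv : v / (n * τ ^ 2) ≤ 1 / 32)
    (hrad : 8 * L / (n * τ) * ∫ p, maxCoord (∑ s ∈ K, ∑ i ∈ b s, σ i p.2 • h i p.1) ∂(Pr.prod ν)
      ≤ K.card / 32) :
    Pr.real {ω | ∃ t, (K.card : ℝ) / 8 ≤ (K.filter fun s =>
        ∑ i ∈ b s, (g i ω t - ∫ ω', g i ω' t ∂Pr) ≤ -(n * τ)).card}
      ≤ Real.exp (-(K.card : ℝ) / 288) := by
  classical
  have hnτ : 0 < n * τ := by positivity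
  set W : κ → Ω → T → ℝ := fun s ω t => ∑ i ∈ b s, (g i ω t - ∫ ω', g i ω' t ∂Pr) with hW
  -- A Lipschitz majorant of the indicator of `x ≤ -nτ`, vanishing for `x ≥ -nτ/2`. Its slope `2 /
  -- (nτ)` yields the factor `8 L / (nτ)` in `hrad`.
  set ψ : ℝ → ℝ := fun x => max 0 (min 1 (-(2 / (n * τ)) * x - 1)) with hψ
  have hψL : ∀ x y, |ψ x - ψ y| ≤ 2 / (n * τ) * |x - y| := fun x y => by
    refine (abs_clip_sub_clip_le _ _).trans_eq ?_
    rw [show -(2 / (n * τ)) * x - 1 - (-(2 / (n * τ)) * y - 1) = -(2 / (n * τ)) * (x - y) by ring,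
      abs_mul, abs_neg, abs_of_pos (by positivity)]
  have hψ0 : ∀ x, 0 ≤ ψ x := fun x => le_max_left _ _
  have hψ1 : ∀ x, ψ x ≤ 1 := fun x => max_le zero_le_one (min_le_left _ _)
  have hψbad : ∀ x, x ≤ -(n * τ) → 1 ≤ ψ x := fun x hx => by
    refine le_max_of_le_right (le_min le_rfl ?_)
    have : 2 / (n * τ) * (n * τ) ≤ 2 / (n * τ) * (-x) :=
      mul_le_mul_of_nonneg_left (by linarith) (by positivity)
    rw [div_mul_cancel₀ _ hnτ.ne'] at this
    linarith
  -- With `y = x / (nτ)` this is `-2y - 1 ≤ y²`, that is `(y + 1)² ≥ 0`; Chebyshev's bound in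
  -- integrated form follows.
  have hψsq : ∀ x, ψ x ≤ (n * τ)⁻¹ ^ 2 * x ^ 2 := fun x => by
    rw [← mul_pow]
    set y := (n * τ)⁻¹ * x with hy
    have hxy : -(2 / (n * τ)) * x - 1 = -2 * y - 1 := by rw [hy]; ring
    simp only [hψ, hxy]
    refine max_le (sq_nonneg _) ((min_le_right _ _).trans ?_)
    nlinarith [sq_nonneg (y + 1)]
  have hψm : Measurable ψ := by fun_prop
  have hgi : ∀ i, Integrable (g i) Pr := fun i =>
    Integrable.of_eval fun t => (hg2 i t).integrable one_le_two
  have hWm : ∀ s, Measurable (W s) := fun s => measurable_pi_lambda _ fun t =>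
    Finset.measurable_fun_sum _ fun i _ => ((measurable_pi_apply t).comp (hgm i)).sub_const _
  have key := integral_maxCoord_block_sum_le (W := W) hgm hhm hσm hgi hhi hlaw ig ih iσ hL hL0 hψL
    (by positivity) K b hb fun s ω t => rfl
  have hψW : ∀ s t, Integrable (fun ω => ψ (W s ω t)) Pr := fun s t =>
    Integrable.of_bound (hψm.comp ((measurable_pi_apply t).comp (hWm s))).aestronglyMeasurable 1
      (ae_of_all _ fun ω => by rw [Real.norm_eq_abs, abs_of_nonneg (hψ0 _)]; exact hψ1 _)
  have hEψ : ∀ s ∈ K, ∀ t, ∫ ω, ψ (W s ω t) ∂Pr ≤ 1 / 32 := by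
    intro s hs t
    have hL2 : ∀ i, MemLp (fun ω => g i ω t - ∫ ω', g i ω' t ∂Pr) 2 Pr := fun i =>
      (hg2 i t).sub (memLp_const _)
    have hWL2 : MemLp (fun ω => W s ω t) 2 Pr := memLp_finsetSum _ fun i _ => hL2 i
    have hmean : ∫ ω, W s ω t ∂Pr = 0 := by
      simp only [hW]
      rw [integral_finsetSum _ fun i _ => (hL2 i).integrable one_le_two]
      refine Finset.sum_eq_zero fun i _ => ?_
      rw [integral_sub ((hg2 i t).integrable one_le_two) (integrable_const _)]
      simp
    have hvarW : ∫ ω, (W s ω t) ^ 2 ∂Pr ≤ n * v := by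
      have h1 : variance (fun ω => W s ω t) Pr = ∫ ω, (W s ω t) ^ 2 ∂Pr := by
        rw [variance_eq_integral hWL2.aestronglyMeasurable.aemeasurable, hmean]
        simp
      have h2 : variance (fun ω => W s ω t) Pr
          = ∑ i ∈ b s, variance (fun ω => g i ω t - ∫ ω', g i ω' t ∂Pr) Pr := by
        have := IndepFun.variance_sum (μ := Pr) (s := b s)
          (X := fun i ω => g i ω t - ∫ ω', g i ω' t ∂Pr) (fun i _ => hL2 i)
          (fun i _ j _ hij => (ig.indepFun hij).comp
            ((measurable_pi_apply t).sub_const _) ((measurable_pi_apply t).sub_const _))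
        rw [← this]
        congr 1
        ext ω
        simp [hW]
      rw [← h1, h2, ← hcard s hs, ← nsmul_eq_mul]
      refine Finset.sum_le_card_nsmul _ _ _ fun i _ => ?_
      rw [variance_sub_const (hg2 i t).aestronglyMeasurable]
      exact hvar i t
    calc ∫ ω, ψ (W s ω t) ∂Pr ≤ ∫ ω, (n * τ)⁻¹ ^ 2 * (W s ω t) ^ 2 ∂Pr :=
          integral_mono (hψW s t) (hWL2.integrable_sq.const_mul _) fun ω => hψsq _
      _ = (n * τ)⁻¹ ^ 2 * ∫ ω, (W s ω t) ^ 2 ∂Pr := integral_const_mul _ _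
      _ ≤ (n * τ)⁻¹ ^ 2 * (n * v) := mul_le_mul_of_nonneg_left hvarW (by positivity)
      _ = v / (n * τ ^ 2) := by field_simp
      _ ≤ 1 / 32 := hv
  have hEsup : ∫ ω, maxCoord (∑ s ∈ K, fun t => ψ (W s ω t) - ∫ ω', ψ (W s ω' t) ∂Pr) ∂Pr
      ≤ K.card / 32 := by
    refine key.trans (le_trans (le_of_eq ?_) hrad)
    rw [← integral_const_mul]
    congr 1 with p
    rw [← maxCoord_smul (by positivity)]
    congr 1
    simp only [Finset.smul_sum]
    refine Finset.sum_congr rfl fun s _ => Finset.sum_congr rfl fun i _ => ?_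
    rw [smul_comm]
    congr 1
    ring
  -- Bounded differences needs vectors of norm at most `1 / 2`, hence `ψ - 1 / 2`; the shift `k`
  -- restores centring at the true means.
  set k : T → ℝ := fun t => ∑ s ∈ K, (1 / 2 - ∫ ω', ψ (W s ω' t) ∂Pr) with hk
  set m : ι → T → ℝ := fun i t => ∫ ω, g i ω t ∂Pr with hm
  have hYm : ∀ i, Measurable fun ω => g i ω - m i := fun i => (hgm i).sub_const (m i)
  have iY : iIndepFun (fun i ω => g i ω - m i) Pr :=
    ig.comp (fun i v => v - m i) fun i => measurable_id.sub_const (m i)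
  have hWY : ∀ s ω, W s ω = ∑ i ∈ b s, (g i ω - m i) := fun s ω => by
    ext t
    simp [hW, hm]
  have hΨ : Measurable fun (v : T → ℝ) t => ψ (v t) - 1 / 2 :=
    measurable_pi_lambda _ fun t => (hψm.comp (measurable_pi_apply t)).sub_const _
  have sub := hasSubgaussianMGF_lipschitz_sum (Pr := Pr) (U := fun s ω t => ψ (W s ω t) - 1 / 2) K
    (fun s _ => hΨ.comp (hWm s))
    (fun s _ ω => (pi_norm_le_iff_of_nonneg (by norm_num)).2 fun t => by
      rw [Real.norm_eq_abs, abs_le]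
      constructor <;> linarith [hψ0 (W s ω t), hψ1 (W s ω t)])
    (fun s hs t ht hst => by
      have := indepFun_sum_groups hYm iY (fun _ => hΨ) s t
        fun r hr => hb s hs r (ht hr) fun e => hst (e ▸ hr)
      simpa only [← hWY] using this)
    (fun u => maxCoord (u + k))
    (LipschitzWith.of_dist_le_mul fun u w => by
      simpa only [dist_add_right] using lipschitzWith_maxCoord.dist_le_mul (u + k) (w + k))
  have hsum : ∀ ω, (∑ s ∈ K, fun t => ψ (W s ω t) - 1 / 2) + k
      = ∑ s ∈ K, fun t => ψ (W s ω t) - ∫ ω', ψ (W s ω' t) ∂Pr := fun ω => by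
    ext t
    simp only [hk, Pi.add_apply, Finset.sum_apply, ← Finset.sum_add_distrib]
    exact Finset.sum_congr rfl fun s _ => by ring
  simp only [hsum] at sub
  -- The means and the expected supremum use up `|K| / 32` each, leaving `|K| / 16 ≥ |K| / 24` of
  -- the threshold `|K| / 8`. With proxy `|K| / 4` the exponent is `(|K| / 24)² / (|K| / 2) = |K| /
  -- 288`.
  have tail := sub.measure_ge_le (ε := (K.card : ℝ) / 24) (by positivity)
  refine (measureReal_mono ?_).trans (tail.trans_eq ?_)
  · rintro ω ⟨t, ht⟩
    have h1 : ((K.filter fun s => W s ω t ≤ -(n * τ)).card : ℝ) ≤ ∑ s ∈ K, ψ (W s ω t) := by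
      rw [Finset.card_eq_sum_ones, Nat.cast_sum, Finset.sum_filter]
      refine Finset.sum_le_sum fun s _ => ?_
      split_ifs with hs
      · simpa using hψbad _ hs
      · exact hψ0 _
    have h2 := le_maxCoord (∑ s ∈ K, fun t => ψ (W s ω t) - ∫ ω', ψ (W s ω' t) ∂Pr) t
    simp only [Finset.sum_apply, Finset.sum_sub_distrib] at h2
    have h3 : ∑ s ∈ K, ∫ ω', ψ (W s ω' t) ∂Pr ≤ K.card / 32 := by
      have := Finset.sum_le_card_nsmul K _ _ fun s hs => hEψ s hs t
      rw [nsmul_eq_mul] at this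
      linarith
    have h4 : (0 : ℝ) ≤ K.card := Nat.cast_nonneg _
    simp only [Set.mem_ofPred_eq]
    have ht' : (K.card : ℝ) / 8 ≤ ((K.filter fun s => W s ω t ≤ -(n * τ)).card : ℝ) := ht
    linarith
  · congr 1
    rcases eq_or_ne (K.card : ℝ) 0 with h0 | h0
    · simp [h0]
    · push_cast
      field_simp
      norm_num

end Blocks

/-! ### Medians from strict majorities -/

section Median

variable {S : ℕ}

/-- Otherwise all indices with value at least `t` would have rank above `k`; there are only `S - 1 -
k ≤ S / 2` such ranks. -/
lemma le_sort_of_card {x : Fin S → ℝ} {t : ℝ}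
    (h : S < 2 * (Finset.univ.filter fun s => t ≤ x s).card) (k : Fin S) (hk : S ≤ 2 * (k + 1)) :
    t ≤ x (Tuple.sort x k) := by
  by_contra! hlt
  have hsub : (Finset.univ.filter fun s => t ≤ x s) ⊆ (Finset.Ioi k).image (Tuple.sort x) := by
    intro s hs
    obtain ⟨j, rfl⟩ := (Tuple.sort x).surjective s
    refine Finset.mem_image_of_mem _ (Finset.mem_Ioi.2 ?_)
    by_contra! hj
    have h1 : x (Tuple.sort x j) ≤ x (Tuple.sort x k) := Tuple.monotone_sort x hj
    have h2 : t ≤ x (Tuple.sort x j) := (Finset.mem_filter.1 hs).2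
    linarith
  have hc := (Finset.card_le_card hsub).trans Finset.card_image_le
  rw [Fin.card_Ioi] at hc
  omega

lemma sort_le_of_card {x : Fin S → ℝ} {t : ℝ}
    (h : S < 2 * (Finset.univ.filter fun s => x s ≤ t).card) (k : Fin S) (hk : 2 * (k : ℕ) ≤ S) :
    x (Tuple.sort x k) ≤ t := by
  by_contra! hlt
  have hsub : (Finset.univ.filter fun s => x s ≤ t) ⊆ (Finset.Iio k).image (Tuple.sort x) := by
    intro s hs
    obtain ⟨j, rfl⟩ := (Tuple.sort x).surjective s
    refine Finset.mem_image_of_mem _ (Finset.mem_Iio.2 ?_)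
    by_contra! hj
    have h1 : x (Tuple.sort x k) ≤ x (Tuple.sort x j) := Tuple.monotone_sort x hj
    have h2 : x (Tuple.sort x j) ≤ t := (Finset.mem_filter.1 hs).2
    linarith
  have hc := (Finset.card_le_card hsub).trans Finset.card_image_le
  rw [Fin.card_Iio] at hc
  omega

lemma pos_of_lt_two_mul_card {p : Fin S → Prop} [DecidablePred p]
    (h : S < 2 * (Finset.univ.filter p).card) : 0 < S := by
  have := Finset.card_filter_le (Finset.univ : Finset (Fin S)) p
  rw [Finset.card_fin] at this
  omega

lemma le_median {x : Fin S → ℝ} {t : ℝ}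
    (h : S < 2 * (Finset.univ.filter fun s => t ≤ x s).card) : t ≤ median x := by
  have hS := pos_of_lt_two_mul_card h
  rw [median, dif_pos hS]
  have h1 := le_sort_of_card h ⟨(S - 1) / 2, by omega⟩ (by simp only; omega)
  have h2 := le_sort_of_card h ⟨S / 2, by omega⟩ (by simp only; omega)
  linarith

lemma median_le {x : Fin S → ℝ} {t : ℝ}
    (h : S < 2 * (Finset.univ.filter fun s => x s ≤ t).card) : median x ≤ t := by
  have hS := pos_of_lt_two_mul_card h
  rw [median, dif_pos hS]
  have h1 := sort_le_of_card h ⟨(S - 1) / 2, by omega⟩ (by simp only; omega)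
  have h2 := sort_le_of_card h ⟨S / 2, by omega⟩ (by simp only; omega)
  linarith

end Median

/-! ### Deterministic analysis on the good event -/

section Deterministic

variable {𝒳 𝒴 : Type*} {N S : ℕ}

/-- The empirical excess loss of `f` on the block `B s`. -/
def blockMean (B : Fin S → Finset (Fin N)) (ℓ : ℝ → 𝒴 → ℝ) (x : Fin N → 𝒳) (y : Fin N → 𝒴)
    (fstar f : 𝒳 → ℝ) (s : Fin S) : ℝ :=
  (1 / ((B s).card : ℝ)) * ∑ i ∈ B s, (ℓ (f (x i)) (y i) - ℓ (fstar (x i)) (y i))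

lemma blockMean_segment_le {B : Fin S → Finset (Fin N)} {ℓ : ℝ → 𝒴 → ℝ} {x : Fin N → 𝒳}
    {y : Fin N → 𝒴} {F : Set (𝒳 → ℝ)} {L : ℝ} (hℓ : IsLipschitzConvexLoss F ℓ L)
    {fstar g : 𝒳 → ℝ} (hfs : fstar ∈ F) (hg : g ∈ F) {t : ℝ} (ht0 : 0 ≤ t) (ht1 : t ≤ 1)
    (s : Fin S) :
    blockMean B ℓ x y fstar (fstar + t • (g - fstar)) s ≤ t * blockMean B ℓ x y fstar g s := by
  rw [blockMean, blockMean, mul_left_comm, Finset.mul_sum _ _ t]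
  refine mul_le_mul_of_nonneg_left (Finset.sum_le_sum fun i _ => ?_) (by positivity)
  have h := hℓ.convex t ht0 ht1 g hg fstar hfs (x i) (y i)
  have e : (fstar + t • (g - fstar)) (x i) = t * g (x i) + (1 - t) * fstar (x i) := by
    simp only [Pi.add_apply, Pi.smul_apply, Pi.sub_apply, smul_eq_mul]
    ring
  rw [e]
  linarith

lemma MOM_eq_median_blockMean (B : Fin S → Finset (Fin N)) (ℓ : ℝ → 𝒴 → ℝ) (x : Fin N → 𝒳)
    (y : Fin N → 𝒴) (fstar f : 𝒳 → ℝ) :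
    MOM B ℓ x y f fstar = median (blockMean B ℓ x y fstar f) := rfl

lemma MOM_eq_median_neg_blockMean (B : Fin S → Finset (Fin N)) (ℓ : ℝ → 𝒴 → ℝ) (x : Fin N → 𝒳)
    (y : Fin N → 𝒴) (fstar f : 𝒳 → ℝ) :
    MOM B ℓ x y fstar f = median fun s => -blockMean B ℓ x y fstar f s := by
  unfold MOM blockMean
  congr 1 with s
  rw [← mul_neg, ← Finset.sum_neg_distrib]
  simp

lemma IsRegularizer.smul_le {E : Submodule ℝ (𝒳 → ℝ)} {F : Set (𝒳 → ℝ)} {φ : (𝒳 → ℝ) → ℝ}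
    {η : ℝ} (hφ : IsRegularizer E F φ η) {h : 𝒳 → ℝ} (hh : h ∈ E) {t : ℝ} (ht0 : 0 ≤ t)
    (ht1 : t ≤ 1) : φ (t • h) ≤ t * φ h := by
  have := hφ.convex.2 (show h ∈ (E : Set _) from hh) (show (0 : 𝒳 → ℝ) ∈ (E : Set _) from E.zero_mem)
    ht0 (sub_nonneg.2 ht1) (by ring)
  simpa [hφ.zero] using this

/-- Quasi-subadditivity is only given on `F`, which need not contain `-g`. Writing `f - g` as the
midpoint of `2f` and `-2g` and using convexity and evenness, it is needed only for `f + f` and `g +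
g`. -/
lemma IsRegularizer.sub_le {E : Submodule ℝ (𝒳 → ℝ)} {F : Set (𝒳 → ℝ)} {φ : (𝒳 → ℝ) → ℝ}
    {η : ℝ} (hφ : IsRegularizer E F φ η) (hFE : F ⊆ (E : Set (𝒳 → ℝ))) {f g : 𝒳 → ℝ} (hf : f ∈ F)
    (hg : g ∈ F) : φ (f - g) ≤ η * (φ f + φ g) := by
  have hf2 : f + f ∈ E := E.add_mem (hFE hf) (hFE hf)
  have hg2 : g + g ∈ E := E.add_mem (hFE hg) (hFE hg)
  have h := hφ.convex.2 (show f + f ∈ (E : Set _) from hf2)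
    (show -(g + g) ∈ (E : Set _) from E.neg_mem hg2)
    (show (0 : ℝ) ≤ 1 / 2 by norm_num) (show (0 : ℝ) ≤ 1 / 2 by norm_num) (by norm_num)
  rw [hφ.even _ hg2] at h
  have e : (1 / 2 : ℝ) • (f + f) + (1 / 2 : ℝ) • (-(g + g)) = f - g := by
    ext z
    simp only [Pi.add_apply, Pi.smul_apply, Pi.neg_apply, Pi.sub_apply, smul_eq_mul]
    ring
  rw [e] at h
  simp only [smul_eq_mul] at h
  linarith [hφ.quasi_add f hf f hf, hφ.quasi_add g hg g hg]

lemma segment_mem {F : Set (𝒳 → ℝ)} (hF : Convex ℝ F) {f g : 𝒳 → ℝ} (hf : f ∈ F) (hg : g ∈ F)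
    {t : ℝ} (ht0 : 0 ≤ t) (ht1 : t ≤ 1) : f + t • (g - f) ∈ F :=
  hF.add_smul_sub_mem hf hg ⟨ht0, ht1⟩

lemma eLpNorm_segment [MeasurableSpace 𝒳] (μ : Measure 𝒳) (f g : 𝒳 → ℝ) {t : ℝ} (ht : 0 ≤ t) :
    eLpNorm (f + t • (g - f) - f) 2 μ = ENNReal.ofReal t * eLpNorm (g - f) 2 μ := by
  rw [add_sub_cancel_left, eLpNorm_const_smul, Real.enorm_eq_ofReal ht]

variable [MeasurableSpace 𝒳] [MeasurableSpace 𝒴]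

/-- The point `g` is contracted by a factor `t` to the localized class, and the block bound there is
divided by `t`. If the contraction stops on the `L₂` sphere, Bernstein gives excess risk at least
`r² / A`; removing `2r² / (3A)` leaves `r² / (3A)`, and `t = r / a` turns this into `a r / (3A)`. If
it stops at the `φ` boundary, only nonnegativity of the excess risk is available, and the loss is
magnified by `φ(g - fstar) / ρ`. -/
lemma exists_lower_bound_blockMean {P : Measure (𝒳 × 𝒴)}
    {E : Submodule ℝ (𝒳 → ℝ)} (hE : IsL2Space (P.map Prod.fst) E)
    {F : Set (𝒳 → ℝ)} (hFE : F ⊆ (E : Set (𝒳 → ℝ))) (hF : Convex ℝ F)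
    {ℓ : ℝ → 𝒴 → ℝ} {L : ℝ} (hℓ : IsLipschitzConvexLoss F ℓ L)
    {fstar : 𝒳 → ℝ} (hfstar : IsOracle P ℓ F fstar)
    {φ : (𝒳 → ℝ) → ℝ} {η : ℝ} (hφ : IsRegularizer E F φ η)
    {B : Fin S → Finset (Fin N)} {x : Fin N → 𝒳} {y : Fin N → 𝒴}
    {A r ρ : ℝ} (hA : 0 < A) (hr : 0 < r) (hρ : 0 < ρ)
    (hBern : ∀ f ∈ F, (eLpNorm (f - fstar) 2 (P.map Prod.fst)).toReal = r → φ (f - fstar) ≤ ρ →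
      r ^ 2 ≤ A * excessRisk P ℓ fstar f)
    (hgood : ∀ f ∈ localClass (P.map Prod.fst) F φ fstar ρ r,
      S < 2 * (Finset.univ.filter fun s =>
        excessRisk P ℓ fstar f - 2 * r ^ 2 / (3 * A) ≤ blockMean B ℓ x y fstar f s).card)
    {g : 𝒳 → ℝ} (hg : g ∈ F) :
    ∃ u : ℝ, S < 2 * (Finset.univ.filter fun s => u ≤ blockMean B ℓ x y fstar g s).card ∧
      ((φ (g - fstar) ≤ ρ ∧ (eLpNorm (g - fstar) 2 (P.map Prod.fst)).toReal ≤ r ∧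
          -(2 * r ^ 2 / (3 * A)) ≤ u) ∨
        (r < (eLpNorm (g - fstar) 2 (P.map Prod.fst)).toReal ∧
          (eLpNorm (g - fstar) 2 (P.map Prod.fst)).toReal * r / (3 * A) ≤ u) ∨
        (ρ < φ (g - fstar) ∧ -(2 * r ^ 2 / (3 * A)) * (φ (g - fstar) / ρ) ≤ u)) := by
  have hfs := hfstar.1
  have hgE : g - fstar ∈ E := E.sub_mem (hFE hg) (hFE hfs)
  have hfin : eLpNorm (g - fstar) 2 (P.map Prod.fst) ≠ ∞ := (hE _ hgE).2.eLpNorm_ne_top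
  set a := (eLpNorm (g - fstar) 2 (P.map Prod.fst)).toReal with ha
  have ha' : eLpNorm (g - fstar) 2 (P.map Prod.fst) = ENNReal.ofReal a :=
    (ENNReal.ofReal_toReal hfin).symm
  have ha0 : 0 ≤ a := ENNReal.toReal_nonneg
  have seg : ∀ t : ℝ, 0 < t → t ≤ 1 → t * a ≤ r → φ (t • (g - fstar)) ≤ ρ →
      fstar + t • (g - fstar) ∈ localClass (P.map Prod.fst) F φ fstar ρ r ∧
      ∀ v, v ≤ excessRisk P ℓ fstar (fstar + t • (g - fstar)) - 2 * r ^ 2 / (3 * A) →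
        S < 2 * (Finset.univ.filter fun s => v / t ≤ blockMean B ℓ x y fstar g s).card := by
    intro t ht0 ht1 hta hφt
    have hmem : fstar + t • (g - fstar) ∈ localClass (P.map Prod.fst) F φ fstar ρ r := by
      refine ⟨segment_mem hF hfs hg ht0.le ht1, ?_, ?_⟩
      · rw [eLpNorm_segment _ _ _ ht0.le, ha', ← ENNReal.ofReal_mul ht0.le]
        exact ENNReal.ofReal_le_ofReal hta
      · rwa [add_sub_cancel_left]
    refine ⟨hmem, fun v hv => (hgood _ hmem).trans_le ?_⟩
    refine Nat.mul_le_mul_left 2 (Finset.card_le_card fun s hs => ?_)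
    rw [Finset.mem_filter] at hs ⊢
    refine ⟨hs.1, ?_⟩
    rw [div_le_iff₀ ht0, mul_comm]
    exact (hv.trans hs.2).trans (blockMean_segment_le hℓ hfs hg ht0.le ht1 s)
  have boundary : r < a → r / a * φ (g - fstar) ≤ ρ →
      S < 2 * (Finset.univ.filter fun s => a * r / (3 * A) ≤ blockMean B ℓ x y fstar g s).card := by
    intro hra hp
    have ha1 : 0 < a := hr.trans hra
    have ht0 : 0 < r / a := by positivity
    have ht1 : r / a ≤ 1 := (div_le_one ha1).2 hra.le
    have hta : r / a * a = r := div_mul_cancel₀ _ ha1.ne'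
    have hφt : φ ((r / a) • (g - fstar)) ≤ ρ := (hφ.smul_le hgE ht0.le ht1).trans hp
    obtain ⟨hmem, hcount⟩ := seg (r / a) ht0 ht1 hta.le hφt
    have hnorm : (eLpNorm (fstar + (r / a) • (g - fstar) - fstar) 2 (P.map Prod.fst)).toReal
        = r := by
      rw [eLpNorm_segment _ _ _ ht0.le, ha', ← ENNReal.ofReal_mul ht0.le, hta,
        ENNReal.toReal_ofReal hr.le]
    have hB := hBern _ hmem.1 hnorm (by rwa [add_sub_cancel_left])
    have := hcount (r ^ 2 / (3 * A)) (by
      have h1 : r ^ 2 / A ≤ excessRisk P ℓ fstar (fstar + (r / a) • (g - fstar)) := by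
        rw [div_le_iff₀ hA, mul_comm]
        exact hB
      have h2 : r ^ 2 / A = r ^ 2 / (3 * A) + 2 * r ^ 2 / (3 * A) := by
        field_simp
        norm_num
      linarith)
    have e : r ^ 2 / (3 * A) / (r / a) = a * r / (3 * A) := by
      field_simp
    rwa [e] at this
  rcases le_or_gt (φ (g - fstar)) ρ with hp | hp
  · rcases le_or_gt a r with har | har
    · refine ⟨-(2 * r ^ 2 / (3 * A)), ?_, Or.inl ⟨hp, har, le_rfl⟩⟩
      have := (seg 1 one_pos le_rfl (by rwa [one_mul]) (by rwa [one_smul])).2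
        (-(2 * r ^ 2 / (3 * A))) (by
          have := hfstar.2 _ (segment_mem hF hfs hg zero_le_one le_rfl)
          linarith)
      rwa [div_one] at this
    · refine ⟨_, boundary har ?_, Or.inr (Or.inl ⟨har, le_rfl⟩)⟩
      have h1 : r / a ≤ 1 := (div_le_one (hr.trans har)).2 har.le
      exact (mul_le_of_le_one_left (hφ.nonneg _ hgE) h1).trans hp
  · have hp0 := hρ.trans hp
    have ht0 : 0 < ρ / φ (g - fstar) := by positivity
    have ht1 : ρ / φ (g - fstar) ≤ 1 := (div_le_one hp0).2 hp.le
    rcases le_or_gt (ρ / φ (g - fstar) * a) r with har | har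
    · refine ⟨_, (seg _ ht0 ht1 har ?_).2 (-(2 * r ^ 2 / (3 * A))) ?_, Or.inr (Or.inr ⟨hp, ?_⟩)⟩
      · exact (hφ.smul_le hgE ht0.le ht1).trans_eq (div_mul_cancel₀ _ hp0.ne')
      · have := hfstar.2 _ (segment_mem hF hfs hg ht0.le ht1)
        linarith
      · rw [div_div_eq_mul_div]
        exact (mul_div_assoc _ _ _).symm.le
    · have hra : r < a := har.trans_le (mul_le_of_le_one_left ha0 ht1)
      refine ⟨_, boundary hra ?_, Or.inr (Or.inl ⟨hra, le_rfl⟩)⟩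
      rw [div_mul_eq_mul_div, div_le_iff₀ (hr.trans hra)]
      rw [div_mul_eq_mul_div, lt_div_iff₀ hp0] at har
      exact har.le

/-- On the event where more than half of the blocks have no large negative deviation, uniformly
over the localized class, the regularized minmax estimator satisfies both error bounds. -/
theorem minmax_bounds_of_good_blocks {P : Measure (𝒳 × 𝒴)}
    {E : Submodule ℝ (𝒳 → ℝ)} (hE : IsL2Space (P.map Prod.fst) E)
    {F : Set (𝒳 → ℝ)} (hFE : F ⊆ (E : Set (𝒳 → ℝ))) (hF : Convex ℝ F)
    {ℓ : ℝ → 𝒴 → ℝ} {L : ℝ} (hℓ : IsLipschitzConvexLoss F ℓ L)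
    {fstar : 𝒳 → ℝ} (hfstar : IsOracle P ℓ F fstar)
    {φ : (𝒳 → ℝ) → ℝ} {η : ℝ} (hφ : IsRegularizer E F φ η)
    {B : Fin S → Finset (Fin N)} {x : Fin N → 𝒳} {y : Fin N → 𝒴}
    {A r lam : ℝ} (hA : 0 < A) (hr : 0 < r) (hφs : 0 < φ fstar) (hlam : r ^ 2 < lam * φ fstar)
    (hBern : ∀ f ∈ F, (eLpNorm (f - fstar) 2 (P.map Prod.fst)).toReal = r →
      φ (f - fstar) ≤ rhoStar φ fstar η A → r ^ 2 ≤ A * excessRisk P ℓ fstar f)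
    (hgood : ∀ f ∈ localClass (P.map Prod.fst) F φ fstar (rhoStar φ fstar η A) r,
      S < 2 * (Finset.univ.filter fun s =>
        excessRisk P ℓ fstar f - 2 * r ^ 2 / (3 * A) ≤ blockMean B ℓ x y fstar f s).card)
    {fhat : 𝒳 → ℝ} (hfhat : IsMinmaxMOM B ℓ F φ lam x y fhat) :
    φ (fhat - fstar) ≤ rhoStar φ fstar η A ∧
      (eLpNorm (fhat - fstar) 2 (P.map Prod.fst)).toReal
        ≤ (4 + 6 * A) * lam * φ fstar / r := by
  have hfs := hfstar.1
  have hη := hφ.eta_pos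
  have hρ : 0 < rhoStar φ fstar η A := by unfold rhoStar; positivity
  have hlam0 : 0 < lam := by
    by_contra! h
    nlinarith [sq_nonneg r]
  set q := lam * φ fstar with hq
  set d := 1 / A with hd
  have hd0 : 0 < d := by positivity
  set τ := 2 * r ^ 2 / (3 * A) with hτ
  have hτd : τ = 2 / 3 * (r ^ 2 * d) := by rw [hτ, hd]; field_simp
  have hr2 : 0 < r ^ 2 := by positivity
  have hτ0 : 0 < τ := by positivity
  have hτq : τ < 2 / 3 * (q * d) := by
    rw [hτd]
    have := mul_lt_mul_of_pos_right hlam hd0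
    linarith
  have hqd : 0 < q * d := mul_pos (hr2.trans hlam) hd0
  have lower := fun g (hg : g ∈ F) =>
    exists_lower_bound_blockMean hE hFE hF hℓ hfstar hφ hA hr hρ hBern hgood hg
  -- The factor `4 + 2 / A` in the radius is chosen for this: beyond it the penalty gain exceeds `2q
  -- + 2q/A`, which dominates the deviation `τ < 2q / (3A)` magnified by the homothety.
  have hpen : ∀ g ∈ F, φ (g - fstar) / rhoStar φ fstar η A * (4 * q + 2 * (q * d)) - 2 * q
      ≤ lam * (φ g - φ fstar) := by
    intro g hg
    have h1 := hφ.sub_le hFE hg hfs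
    have h2 : φ (g - fstar) / rhoStar φ fstar η A * (4 * q + 2 * (q * d))
        = lam * (φ (g - fstar) / η) := by
      rw [rhoStar, hq, hd]
      have : (4 + 2 / A) ≠ 0 := by positivity
      field_simp
    have h3 : φ (g - fstar) / η ≤ φ g + φ fstar := by
      rw [div_le_iff₀ hη]
      linarith
    rw [h2]
    have := mul_le_mul_of_nonneg_left h3 hlam0.le
    rw [hq]
    linarith
  have upper : minmaxObjective B ℓ F φ lam x y fstar ≤ ((τ + q : ℝ) : EReal) := by
    refine iSup₂_le fun g hg => EReal.coe_le_coe_iff.2 ?_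
    obtain ⟨u, hu, hcase⟩ := lower g hg
    have hM : MOM B ℓ x y fstar g ≤ -u := by
      rw [MOM_eq_median_neg_blockMean]
      exact median_le (by simpa only [neg_le_neg_iff] using hu)
    have hφg := mul_nonneg hlam0.le (hφ.nonneg g (hFE hg))
    rw [mul_sub]
    rcases hcase with ⟨-, -, h⟩ | ⟨h1, h⟩ | ⟨h1, h⟩
    · linarith
    · have : 0 ≤ (eLpNorm (g - fstar) 2 (P.map Prod.fst)).toReal * r / (3 * A) := by positivity
      linarith
    · have hw := (one_lt_div hρ).2 h1
      have hp := hpen g hg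
      set w := φ (g - fstar) / rhoStar φ fstar η A
      have : 0 < (w - 1) * (4 * q + 2 * (q * d) - τ) :=
        mul_pos (by linarith) (by linarith)
      nlinarith
  have hobj : MOM B ℓ x y fhat fstar + lam * (φ fhat - φ fstar) ≤ τ + q := by
    have h1 : ((MOM B ℓ x y fhat fstar + lam * (φ fhat - φ fstar) : ℝ) : EReal)
        ≤ minmaxObjective B ℓ F φ lam x y fhat :=
      le_iSup₂ (f := fun g (_ : g ∈ F) =>
        ((MOM B ℓ x y fhat g + lam * (φ fhat - φ g) : ℝ) : EReal)) fstar hfs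
    exact EReal.coe_le_coe_iff.1 ((h1.trans (hfhat.2 fstar hfs)).trans upper)
  obtain ⟨u, hu, hcase⟩ := lower fhat hfhat.1
  have hM : u ≤ MOM B ℓ x y fhat fstar := by
    rw [MOM_eq_median_blockMean]
    exact le_median hu
  have hp := hpen fhat hfhat.1
  have hφh := mul_nonneg hlam0.le (hφ.nonneg fhat (hFE hfhat.1))
  set a := (eLpNorm (fhat - fstar) 2 (P.map Prod.fst)).toReal with ha
  have ha0 : 0 ≤ a := ENNReal.toReal_nonneg
  -- For `w > 1` the objective tested at `fstar` is at least `w (4q + 2qd - τ) - 2q > 2q + 2qd - τ >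
  -- τ + q` in the worst case, contradicting `hobj`.
  have first : φ (fhat - fstar) ≤ rhoStar φ fstar η A := by
    by_contra! hlt
    have hw := (one_lt_div hρ).2 hlt
    set w := φ (fhat - fstar) / rhoStar φ fstar η A
    rcases hcase with ⟨h, -, -⟩ | ⟨-, h⟩ | ⟨-, h⟩
    · linarith
    · have h0 : 0 ≤ a * r / (3 * A) := by positivity
      have : 0 < (w - 1) * (4 * q + 2 * (q * d)) := mul_pos (by linarith) (by linarith)
      nlinarith
    · have : 0 < (w - 1) * (4 * q + 2 * (q * d) - τ) :=
        mul_pos (by linarith) (by linarith)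
      nlinarith
  refine ⟨first, ?_⟩
  rw [le_div_iff₀ hr, mul_assoc _ lam, ← hq]
  have hqA : 0 < A * q := mul_pos hA (hr2.trans hlam)
  -- Outside the ball, `a r ≤ 3A (τ + 2q) = 2r² + 6A q`, and `r² < q`.
  rcases hcase with ⟨-, h, -⟩ | ⟨-, h⟩ | ⟨h, -⟩
  · have : a * r ≤ r ^ 2 := by rw [sq]; exact mul_le_mul_of_nonneg_right h hr.le
    nlinarith
  · have h1 : a * r / (3 * A) ≤ τ + 2 * q := by
      rw [mul_sub, ← hq] at hobj
      linarith
    rw [div_le_iff₀ (by positivity)] at h1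
    have h2 : τ * (3 * A) = 2 * r ^ 2 := by rw [hτ]; field_simp
    nlinarith
  · linarith

end Deterministic

/-! ### Complexity at the fixed point -/

section Complexity

variable {Ω 𝒳 : Type*} [MeasurableSpace Ω] {N : ℕ}

lemma rademacherComplexity_mono (Pr : Measure Ω) (X : Fin N → Ω → 𝒳) (fstar : 𝒳 → ℝ)
    {G G' : Set (𝒳 → ℝ)} (h : G ⊆ G') (J : Finset (Fin N)) :
    rademacherComplexity Pr X fstar G J ≤ rademacherComplexity Pr X fstar G' J :=
  lintegral_mono fun _ => biSup_mono fun _ hf => h hf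

variable [MeasurableSpace 𝒳]

lemma localClass_mono (μ : Measure 𝒳) (F : Set (𝒳 → ℝ)) (φ : (𝒳 → ℝ) → ℝ) (fstar : 𝒳 → ℝ)
    (ρ : ℝ) {r r' : ℝ} (h : r ≤ r') :
    localClass μ F φ fstar ρ r ⊆ localClass μ F φ fstar ρ r' := fun _ hf =>
  ⟨hf.1, hf.2.1.trans (ENNReal.ofReal_le_ofReal h), hf.2.2⟩

/-- Since the localized class is star-shaped around `fstar`, the complexity grows at most linearly
with the radius. -/
lemma rademacherComplexity_localClass_le_mul (Pr : Measure Ω) (μ : Measure 𝒳)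
    {E : Submodule ℝ (𝒳 → ℝ)} {F : Set (𝒳 → ℝ)} (hFE : F ⊆ (E : Set (𝒳 → ℝ))) (hF : Convex ℝ F)
    {φ : (𝒳 → ℝ) → ℝ} {η : ℝ} (hφ : IsRegularizer E F φ η) {fstar : 𝒳 → ℝ} (hfs : fstar ∈ F)
    (X : Fin N → Ω → 𝒳) (ρ : ℝ) {r r' : ℝ} (hr : 0 < r) (hrr : r ≤ r') (J : Finset (Fin N)) :
    rademacherComplexity Pr X fstar (localClass μ F φ fstar ρ r') J
      ≤ ENNReal.ofReal (r' / r)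
        * rademacherComplexity Pr X fstar (localClass μ F φ fstar ρ r) J := by
  unfold rademacherComplexity
  rw [← lintegral_const_mul' _ _ ENNReal.ofReal_ne_top]
  refine lintegral_mono fun p => iSup₂_le fun f hf => ?_
  have hr' : 0 < r' := hr.trans_le hrr
  have ht0 : 0 ≤ r / r' := by positivity
  have ht1 : r / r' ≤ 1 := (div_le_one hr').2 hrr
  have hfE : f - fstar ∈ E := E.sub_mem (hFE hf.1) (hFE hfs)
  have hmem : fstar + (r / r') • (f - fstar) ∈ localClass μ F φ fstar ρ r := by
    refine ⟨segment_mem hF hfs hf.1 ht0 ht1, ?_, ?_⟩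
    · rw [eLpNorm_segment _ _ _ ht0]
      refine (mul_le_mul_right hf.2.1 _).trans_eq ?_
      rw [← ENNReal.ofReal_mul ht0, div_mul_cancel₀ _ hr'.ne']
    · rw [add_sub_cancel_left]
      exact (hφ.smul_le hfE ht0 ht1).trans
        ((mul_le_of_le_one_left (hφ.nonneg _ hfE) ht1).trans hf.2.2)
  refine le_trans (le_of_eq ?_) (mul_le_mul_right (le_iSup₂ (f := fun f
    (_ : f ∈ localClass μ F φ fstar ρ r) =>
      ENNReal.ofReal |∑ i ∈ J, p.2 i * (f (X i p.1) - fstar (X i p.1))|) _ hmem) _)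
  rw [← ENNReal.ofReal_mul (by positivity)]
  congr 1
  rw [← abs_of_nonneg (show 0 ≤ r' / r by positivity), ← abs_mul, Finset.mul_sum]
  congr 1
  refine Finset.sum_congr rfl fun i _ => ?_
  simp only [Pi.add_apply, Pi.smul_apply, Pi.sub_apply, smul_eq_mul, add_sub_cancel_left]
  field_simp

/-- Linear growth against the quadratic bound `r²` makes every radius above an admissible one
admissible. This covers all `r' > r`; letting `r'` decrease to `r` handles the infimum itself. -/
lemma rademacherComplexity_le_of_rTilde_le (Pr : Measure Ω) (μ : Measure 𝒳)
    {E : Submodule ℝ (𝒳 → ℝ)} {F : Set (𝒳 → ℝ)} (hFE : F ⊆ (E : Set (𝒳 → ℝ))) (hF : Convex ℝ F)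
    {φ : (𝒳 → ℝ) → ℝ} {η : ℝ} (hφ : IsRegularizer E F φ η) {fstar : 𝒳 → ℝ} (hfs : fstar ∈ F)
    (X : Fin N → Ω → 𝒳) (I : Finset (Fin N)) {L A r : ℝ} (hL : 0 < L) (hA : 0 < A) (hr : 0 < r)
    (h : rTilde Pr μ F φ fstar X I η L A ≤ ENNReal.ofReal r) {J : Finset (Fin N)} (hJ : J ⊆ I)
    (hcard : (N : ℝ) / 2 ≤ J.card) :
    rademacherComplexity Pr X fstar (localClass μ F φ fstar (rhoStar φ fstar η A) r) J
      ≤ ENNReal.ofReal ((384 * A * L)⁻¹ * r ^ 2 * J.card) := by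
  have step : ∀ r', r < r' →
      rademacherComplexity Pr X fstar (localClass μ F φ fstar (rhoStar φ fstar η A) r) J
        ≤ ENNReal.ofReal ((384 * A * L)⁻¹ * r' ^ 2 * J.card) := by
    intro r' hr'
    have hr'0 : 0 < r' := hr.trans hr'
    have hlt : rTilde Pr μ F φ fstar X I η L A < ENNReal.ofReal r' :=
      h.trans_lt ((ENNReal.ofReal_lt_ofReal_iff (hr.trans hr')).2 hr')
    obtain ⟨_, ⟨r₀, ⟨hr₀, hr₀b⟩, rfl⟩, hr₀'⟩ := sInf_lt_iff.1 hlt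
    have hr₀r : r₀ < r' := (ENNReal.ofReal_lt_ofReal_iff (hr.trans hr')).1 hr₀'
    refine (rademacherComplexity_mono Pr X fstar
      (localClass_mono μ F φ fstar _ hr'.le) J).trans ?_
    refine (rademacherComplexity_localClass_le_mul Pr μ hFE hF hφ hfs X _ hr₀ hr₀r.le J).trans ?_
    refine (mul_le_mul_right (hr₀b J hJ hcard) _).trans ?_
    rw [← ENNReal.ofReal_mul (by positivity)]
    refine ENNReal.ofReal_le_ofReal ?_
    have e : r' / r₀ * ((384 * A * L)⁻¹ * r₀ ^ 2 * J.card)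
        = (384 * A * L)⁻¹ * (r' * r₀) * J.card := by
      field_simp
    rw [e]
    have : r' * r₀ ≤ r' ^ 2 := by nlinarith
    gcongr
  have hcont : Tendsto (fun r' : ℝ => ENNReal.ofReal ((384 * A * L)⁻¹ * r' ^ 2 * J.card)) (𝓝[>] r)
      (𝓝 (ENNReal.ofReal ((384 * A * L)⁻¹ * r ^ 2 * J.card))) := by
    have : Continuous fun r' : ℝ => ENNReal.ofReal ((384 * A * L)⁻¹ * r' ^ 2 * J.card) :=
      ENNReal.continuous_ofReal.comp (by fun_prop)
    exact (this.tendsto r).mono_left nhdsWithin_le_nhds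
  exact ge_of_tendsto hcont (eventually_nhdsWithin_of_forall step)

end Complexity

/-! ### Continuity of the excess risk along pointwise limits -/

section Limits

variable {Ω : Type*} [MeasurableSpace Ω] {μ : Measure Ω}

lemma integral_sq_le_of_eLpNorm_le {h : Ω → ℝ} (hm : AEStronglyMeasurable h μ) {r : ℝ} (hr : 0 ≤ r)
    (hle : eLpNorm h 2 μ ≤ ENNReal.ofReal r) : ∫ ω, h ω ^ 2 ∂μ ≤ r ^ 2 := by
  have hL2 : MemLp h 2 μ := ⟨hm, hle.trans_lt ENNReal.ofReal_lt_top⟩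
  have h1 := hL2.eLpNorm_eq_integral_rpow_norm two_ne_zero ENNReal.ofNat_ne_top
  rw [h1] at hle
  have h2 := (ENNReal.ofReal_le_ofReal_iff hr).1 hle
  simp only [ENNReal.toReal_ofNat, Real.rpow_ofNat, Real.norm_eq_abs, sq_abs] at h2
  rw [show (2 : ℝ)⁻¹ = 1 / 2 by norm_num, ← Real.sqrt_eq_rpow] at h2
  exact (Real.sqrt_le_left hr).1 h2

/-- An `L₂` bound gives uniform integrability: `|h| ≤ min |h| M + h² / M`, where dominated
convergence handles the first term and `V / M` is small. -/
lemma tendsto_integral_zero_of_integral_sq_le [IsFiniteMeasure μ] {h : ℕ → Ω → ℝ} {V : ℝ}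
    (hL2 : ∀ n, MemLp (h n) 2 μ) (hV : ∀ n, ∫ ω, h n ω ^ 2 ∂μ ≤ V)
    (hlim : ∀ ω, Tendsto (fun n => h n ω) atTop (𝓝 0)) :
    Tendsto (fun n => ∫ ω, h n ω ∂μ) atTop (𝓝 0) := by
  rw [Metric.tendsto_atTop]
  intro ε hε
  have hV0 : 0 ≤ V := (integral_nonneg fun ω => sq_nonneg (h 0 ω)).trans (hV 0)
  set M : ℝ := (2 * V + 1) / ε with hM
  have hM0 : 0 < M := by positivity
  have hVM : M⁻¹ * V < ε / 2 := by
    rw [hM, inv_div, div_mul_eq_mul_div, div_lt_iff₀ (by positivity)]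
    nlinarith
  have hdct : Tendsto (fun n => ∫ ω, min |h n ω| M ∂μ) atTop (𝓝 (∫ _, (0 : ℝ) ∂μ)) := by
    refine tendsto_integral_of_dominated_convergence (fun _ => M)
      (fun n => ((hL2 n).1.norm.aemeasurable.min aemeasurable_const).aestronglyMeasurable)
      (integrable_const M) (fun n => ae_of_all _ fun ω => ?_) (ae_of_all _ fun ω => ?_)
    · rw [Real.norm_eq_abs, abs_of_nonneg (le_min (abs_nonneg _) hM0.le)]
      exact min_le_right _ _
    · have := ((hlim ω).abs).min (tendsto_const_nhds (x := M))
      simpa [hM0.le] using this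
  rw [integral_zero, Metric.tendsto_atTop] at hdct
  obtain ⟨n₀, hn₀⟩ := hdct (ε / 2) (by positivity)
  refine ⟨n₀, fun n hn => ?_⟩
  have h1 := hn₀ n hn
  rw [Real.dist_eq, sub_zero] at h1 ⊢
  have h2 := (le_abs_self _).trans_lt h1
  have hint : Integrable (fun ω => min |h n ω| M) μ :=
    Integrable.of_bound ((hL2 n).1.norm.aemeasurable.min aemeasurable_const).aestronglyMeasurable M
      (ae_of_all _ fun ω => by
        rw [Real.norm_eq_abs, abs_of_nonneg (le_min (abs_nonneg _) hM0.le)]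
        exact min_le_right _ _)
  calc |∫ ω, h n ω ∂μ| ≤ ∫ ω, |h n ω| ∂μ := abs_integral_le_integral_abs
    _ ≤ ∫ ω, (min |h n ω| M + M⁻¹ * h n ω ^ 2) ∂μ := by
        refine integral_mono ((hL2 n).integrable one_le_two).abs
          (hint.add ((hL2 n).integrable_sq.const_mul _)) fun ω => ?_
        simp only
        rcases le_total |h n ω| M with hle | hle
        · rw [min_eq_left hle]
          have : 0 ≤ M⁻¹ * h n ω ^ 2 := by positivity
          linarith
        · rw [min_eq_right hle, ← sq_abs, sq]
          have : M⁻¹ * (M * |h n ω|) ≤ M⁻¹ * (|h n ω| * |h n ω|) := by gcongr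
          rw [inv_mul_cancel_left₀ hM0.ne'] at this
          linarith
    _ = ∫ ω, min |h n ω| M ∂μ + M⁻¹ * ∫ ω, h n ω ^ 2 ∂μ := by
        rw [integral_add hint ((hL2 n).integrable_sq.const_mul _), integral_const_mul]
    _ ≤ ∫ ω, min |h n ω| M ∂μ + M⁻¹ * V := by
        gcongr
        exact hV n
    _ < ε := by linarith

variable {𝒳 𝒴 : Type*} [MeasurableSpace 𝒳] [MeasurableSpace 𝒴]

/-- Pointwise limits alone do not control risks; the localized class has `L₂` diameter at most `2r`,
which supplies the needed uniform integrability through the Lipschitz loss. -/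
lemma tendsto_excessRisk {P : Measure (𝒳 × 𝒴)} [IsProbabilityMeasure P]
    {E : Submodule ℝ (𝒳 → ℝ)} (hE : IsL2Space (P.map Prod.fst) E)
    {F : Set (𝒳 → ℝ)} (hFE : F ⊆ (E : Set (𝒳 → ℝ)))
    {ℓ : ℝ → 𝒴 → ℝ} {L : ℝ} (hℓ : IsLipschitzConvexLoss F ℓ L)
    (hℓ_meas : ∀ f ∈ F, Measurable fun z : 𝒳 × 𝒴 => ℓ (f z.1) z.2)
    {fstar : 𝒳 → ℝ} (hfs : fstar ∈ F) {φ : (𝒳 → ℝ) → ℝ} {ρ r : ℝ} (hr : 0 ≤ r)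
    {u : ℕ → 𝒳 → ℝ} (hu : ∀ n, u n ∈ localClass (P.map Prod.fst) F φ fstar ρ r)
    {f : 𝒳 → ℝ} (hf : f ∈ localClass (P.map Prod.fst) F φ fstar ρ r)
    (hlim : ∀ x, Tendsto (fun n => u n x) atTop (𝓝 (f x))) :
    Tendsto (fun n => excessRisk P ℓ fstar (u n)) atTop (𝓝 (excessRisk P ℓ fstar f)) := by
  have hL := hℓ.pos
  have hmp : MeasurePreserving Prod.fst P (P.map Prod.fst) := ⟨measurable_fst, rfl⟩
  have hdiff : ∀ g ∈ F, ∀ g' ∈ F, MemLp (fun z : 𝒳 × 𝒴 => g z.1 - g' z.1) 2 P :=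
    fun g hg g' hg' =>
      ((hE _ (E.sub_mem (hFE hg) (hFE hg'))).2).comp_measurePreserving hmp
  have hloss : ∀ g ∈ F, ∀ g' ∈ F,
      MemLp (fun z : 𝒳 × 𝒴 => ℓ (g z.1) z.2 - ℓ (g' z.1) z.2) 2 P := fun g hg g' hg' =>
    (hdiff g hg g' hg').of_le_mul (c := L)
      ((hℓ_meas g hg).sub (hℓ_meas g' hg')).aestronglyMeasurable
      (ae_of_all _ fun z => hℓ.lipschitz g hg g' hg' z.1 z.2)
  have hzero := tendsto_integral_zero_of_integral_sq_le (μ := P)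
    (h := fun n z => ℓ (u n z.1) z.2 - ℓ (f z.1) z.2) (V := L ^ 2 * (2 * r) ^ 2)
    (fun n => hloss _ (hu n).1 _ hf.1)
    (fun n => by
      have hfm := (hE _ (hFE hf.1)).1
      have hum := (hE _ (hFE (hu n).1)).1
      have hsm := (hE _ (hFE hfs)).1
      have hnorm : eLpNorm (fun z : 𝒳 × 𝒴 => u n z.1 - f z.1) 2 P ≤ ENNReal.ofReal (2 * r) := by
        have e : eLpNorm (fun z : 𝒳 × 𝒴 => u n z.1 - f z.1) 2 P
            = eLpNorm (u n - f) 2 (P.map Prod.fst) :=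
          eLpNorm_comp_measurePreserving (g := u n - f) (hum.sub hfm).aestronglyMeasurable hmp
        rw [e, ← sub_sub_sub_cancel_right (u n) f fstar, two_mul, ENNReal.ofReal_add hr hr]
        exact (eLpNorm_sub_le (hum.sub hsm).aestronglyMeasurable
          (hfm.sub hsm).aestronglyMeasurable one_le_two).trans (add_le_add (hu n).2.1 hf.2.1)
      have hsq := integral_sq_le_of_eLpNorm_le (hdiff _ (hu n).1 _ hf.1).1 (by positivity) hnorm
      calc ∫ z, (ℓ (u n z.1) z.2 - ℓ (f z.1) z.2) ^ 2 ∂P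
          ≤ ∫ z, L ^ 2 * (u n z.1 - f z.1) ^ 2 ∂P := by
            refine integral_mono (hloss _ (hu n).1 _ hf.1).integrable_sq
              ((hdiff _ (hu n).1 _ hf.1).integrable_sq.const_mul _) fun z => ?_
            rw [← mul_pow]
            rw [← sq_abs, ← sq_abs (L * _), abs_mul, abs_of_pos hL]
            exact pow_le_pow_left₀ (abs_nonneg _) (hℓ.lipschitz _ (hu n).1 _ hf.1 z.1 z.2) 2
        _ ≤ L ^ 2 * (2 * r) ^ 2 := by
            rw [integral_const_mul]
            gcongr)
    (fun z => by
      have h1 : Tendsto (fun n => L * |u n z.1 - f z.1|) atTop (𝓝 0) := by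
        have := (((hlim z.1).sub_const (f z.1)).abs).const_mul L
        simpa using this
      exact squeeze_zero_norm (fun n => hℓ.lipschitz _ (hu n).1 _ hf.1 z.1 z.2) h1)
  have h2 := hzero.add_const (excessRisk P ℓ fstar f)
  rw [zero_add] at h2
  refine h2.congr fun n => ?_
  rw [excessRisk, excessRisk, ← integral_add ((hloss _ (hu n).1 _ hf.1).integrable one_le_two)
    ((hloss _ hf.1 _ hfs).integrable one_le_two)]
  congr 1 with z
  ring

end Limits

/-! ### The bad event for finite subclasses -/

section Event

variable {Ω 𝒳 𝒴 : Type*} [MeasurableSpace Ω] [MeasurableSpace 𝒳] [MeasurableSpace 𝒴] {N S : ℕ}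

/-- The blocks that contain informative data only. -/
def informativeBlocks (B : Fin S → Finset (Fin N)) (I : Finset (Fin N)) : Finset (Fin S) :=
  Finset.univ.filter fun s => B s ⊆ I

lemma mem_informativeBlocks {B : Fin S → Finset (Fin N)} {I : Finset (Fin N)} {s : Fin S} :
    s ∈ informativeBlocks B I ↔ B s ⊆ I := by
  simp [informativeBlocks]

/-- Choosing an outlier in each non-informative block is injective, as blocks are disjoint. -/
lemma le_card_informativeBlocks {B : Fin S → Finset (Fin N)} (hB : IsBlockPartition B)
    (hN : 0 < N) (I : Finset (Fin N)) : S ≤ (informativeBlocks B I).card + (Iᶜ).card := by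
  have : Nonempty (Fin N) := ⟨⟨0, hN⟩⟩
  have hex : ∀ s : Fin S, s ∉ informativeBlocks B I → ∃ i ∈ B s, i ∉ I := fun s hs => by
    rwa [mem_informativeBlocks, Finset.not_subset] at hs
  choose! w hwB hwI using hex
  have hc : (informativeBlocks B I)ᶜ.card ≤ (Iᶜ).card := by
    refine Finset.card_le_card_of_injOn w (fun s hs => ?_) fun s hs t ht hst => ?_
    · exact Finset.mem_compl.2 (hwI s (Finset.mem_compl.1 hs))
    · by_contra hne
      have h1 := hwB s (Finset.mem_compl.1 hs)
      have h2 := hwB t (Finset.mem_compl.1 ht)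
      rw [hst] at h1
      exact Finset.disjoint_left.1 (hB.disjoint hne) h1 h2
  have := Finset.card_add_card_compl (informativeBlocks B I)
  rw [Fintype.card_fin] at this
  omega

lemma integral_le_of_lintegral_ofReal_le {μ : Measure Ω} {f : Ω → ℝ} {c : ℝ} (hc : 0 ≤ c)
    (h : ∫⁻ ω, ENNReal.ofReal (f ω) ∂μ ≤ ENNReal.ofReal c) : ∫ ω, f ω ∂μ ≤ c := by
  by_cases hf : Integrable f μ
  · rw [integral_eq_lintegral_pos_part_sub_lintegral_neg_part hf]
    have h1 := ENNReal.toReal_le_of_le_ofReal hc h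
    have h2 : 0 ≤ (∫⁻ ω, ENNReal.ofReal (-f ω) ∂μ).toReal := ENNReal.toReal_nonneg
    linarith
  · rwa [integral_undef hf]

/-- The event that too many informative blocks have a large negative deviation for `f`. -/
def badEvent (P : Measure (𝒳 × 𝒴)) (ℓ : ℝ → 𝒴 → ℝ) (X : Fin N → Ω → 𝒳) (Y : Fin N → Ω → 𝒴)
    (I : Finset (Fin N)) (B : Fin S → Finset (Fin N)) (fstar : 𝒳 → ℝ) (τ : ℝ) (f : 𝒳 → ℝ) :
    Set Ω :=
  {ω | ((informativeBlocks B I).card : ℝ) / 8 ≤ ((informativeBlocks B I).filter fun s =>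
    blockMean B ℓ (fun i => X i ω) (fun i => Y i ω) fstar f s
      ≤ excessRisk P ℓ fstar f - τ).card}

theorem measureReal_biUnion_badEvent_le
    {Pr : Measure Ω} [IsProbabilityMeasure Pr] {P : Measure (𝒳 × 𝒴)} [IsProbabilityMeasure P]
    {E : Submodule ℝ (𝒳 → ℝ)} (hE : IsL2Space (P.map Prod.fst) E)
    {F : Set (𝒳 → ℝ)} (hFE : F ⊆ (E : Set (𝒳 → ℝ)))
    {ℓ : ℝ → 𝒴 → ℝ} {L : ℝ} (hℓ : IsLipschitzConvexLoss F ℓ L)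
    (hℓ_meas : ∀ f ∈ F, Measurable fun z : 𝒳 × 𝒴 => ℓ (f z.1) z.2)
    {fstar : 𝒳 → ℝ} (hfs : fstar ∈ F) {φ : (𝒳 → ℝ) → ℝ} (hN : 0 < N)
    {X : Fin N → Ω → 𝒳} {Y : Fin N → Ω → 𝒴} {I : Finset (Fin N)}
    (hI : IsInformative Pr P ℓ F fstar X Y I)
    {B : Fin S → Finset (Fin N)} (hB : IsBlockPartition B)
    (hS : 7 * ((Iᶜ).card : ℝ) / 3 ≤ (S : ℝ)) {A : ℝ} (hA : 0 < A) {r ρ : ℝ} (hr : 0 < r)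
    (hr2 : 368 * A ^ 2 * L ^ 2 * ((S : ℝ) / (N : ℝ)) ≤ r ^ 2)
    (hcomp : ∀ J ⊆ I, (N : ℝ) / 2 ≤ (J.card : ℝ) →
      rademacherComplexity Pr X fstar (localClass (P.map Prod.fst) F φ fstar ρ r) J
        ≤ ENNReal.ofReal ((384 * A * L)⁻¹ * r ^ 2 * J.card))
    (G : Finset (𝒳 → ℝ)) (hG : ↑G ⊆ localClass (P.map Prod.fst) F φ fstar ρ r)
    (hG0 : G.Nonempty) :
    Pr.real (⋃ f ∈ G, badEvent P ℓ X Y I B fstar (2 * r ^ 2 / (3 * A)) f)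
      ≤ Real.exp (-(S : ℝ) / 504) := by
  classical
  have hL := hℓ.pos
  have hSpos : 0 < S := by
    obtain ⟨s, -⟩ := hB.cover ⟨0, hN⟩
    exact s.pos
  set n : ℕ := (B ⟨0, hSpos⟩).card with hn
  have hnS : n * S = N := hB.card_eq _
  have hBn : ∀ s, (B s).card = n := fun s =>
    Nat.eq_of_mul_eq_mul_right hSpos ((hB.card_eq s).trans hnS.symm)
  have hn0 : 0 < n := Nat.pos_of_ne_zero fun h => by
    rw [h, zero_mul] at hnS
    omega
  have hnR : (0 : ℝ) < n := Nat.cast_pos.2 hn0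
  have hSR : (0 : ℝ) < S := Nat.cast_pos.2 hSpos
  have hnSR : (n : ℝ) * S = N := by exact_mod_cast hnS
  set K := informativeBlocks B I with hK
  have hKcard : 4 / 7 * (S : ℝ) ≤ K.card := by
    have h1 : (S : ℝ) ≤ K.card + (Iᶜ).card := by exact_mod_cast le_card_informativeBlocks hB hN I
    linarith
  set τ := 2 * r ^ 2 / (3 * A) with hτ
  have hτ0 : 0 < τ := by positivity
  have hGF : ∀ f : G, (f : 𝒳 → ℝ) ∈ F := fun f => (hG f.2).1
  have hne : Nonempty G := hG0.to_subtype
  set b : Fin S → Finset I := fun s => (B s).subtype (· ∈ I) with hb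
  have hbsum : ∀ s ∈ K, ∀ {M : Type} [AddCommMonoid M] (q : Fin N → M),
      ∑ i ∈ b s, q i = ∑ i ∈ B s, q i := fun s hs M _ q =>
    Finset.sum_subtype_of_mem q fun i hi => mem_informativeBlocks.1 hs hi
  have hbcard : ∀ s ∈ K, (b s).card = n := fun s hs => by
    have := hbsum s hs (fun _ => 1)
    simp only [Finset.sum_const, smul_eq_mul, mul_one] at this
    rw [this, hBn]
  set g : I → Ω → G → ℝ := fun i ω f =>
    ℓ ((f : 𝒳 → ℝ) (X i ω)) (Y i ω) - ℓ (fstar (X i ω)) (Y i ω) with hg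
  set h : I → Ω → G → ℝ := fun i ω f => (f : 𝒳 → ℝ) (X i ω) - fstar (X i ω) with hh
  set σ : I → (Fin N → ℝ) → ℝ := fun i e => e i with hσ
  have hZ : ∀ i : I, Measurable fun ω => (X i ω, Y i ω) := fun i =>
    (hI.measurable_X i i.2).prodMk (hI.measurable_Y i i.2)
  have hgz : Measurable fun (z : 𝒳 × 𝒴) (f : G) => ℓ ((f : 𝒳 → ℝ) z.1) z.2 - ℓ (fstar z.1) z.2 :=
    measurable_pi_lambda _ fun f => (hℓ_meas f (hGF f)).sub (hℓ_meas fstar hfs)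
  have hhz : Measurable fun (z : 𝒳 × 𝒴) (f : G) => (f : 𝒳 → ℝ) z.1 - fstar z.1 :=
    measurable_pi_lambda _ fun f =>
      (((hE _ (hFE (hGF f))).1).comp measurable_fst).sub
        (((hE _ (hFE hfs)).1).comp measurable_fst)
  have hgm : ∀ i, Measurable (g i) := fun i => hgz.comp (hZ i)
  have hhm : ∀ i, Measurable (h i) := fun i => hhz.comp (hZ i)
  have hσm : ∀ i, Measurable (σ i) := fun i => measurable_pi_apply _
  have hhnorm : ∀ i (f : G), eLpNorm (fun ω => h i ω f) 2 Pr ≤ ENNReal.ofReal r := fun i f => by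
    rw [hh]
    exact (hI.same_L2 i i.2 f (hGF f)).trans_le (hG f.2).2.1
  have hh2 : ∀ i (f : G), MemLp (fun ω => h i ω f) 2 Pr := fun i f =>
    ⟨((measurable_pi_apply f).comp (hhm i)).aestronglyMeasurable,
      (hhnorm i f).trans_lt ENNReal.ofReal_lt_top⟩
  have hgh : ∀ i ω (f : G), ‖g i ω f‖ ≤ L * ‖h i ω f‖ := fun i ω f =>
    hℓ.lipschitz f (hGF f) fstar hfs _ _
  have hg2 : ∀ i (f : G), MemLp (fun ω => g i ω f) 2 Pr := fun i f =>
    (hh2 i f).of_le_mul (c := L) ((measurable_pi_apply f).comp (hgm i)).aestronglyMeasurable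
      (ae_of_all _ fun ω => hgh i ω f)
  have hlaw : ∀ i, (Measure.pi fun _ : Fin N => rademacher).map (σ i) = rademacher := fun i =>
    (measurePreserving_eval (fun _ : Fin N => rademacher) (i : Fin N)).map_eq
  have iσ : iIndepFun σ (Measure.pi fun _ : Fin N => rademacher) :=
    (iIndepFun_pi (μ := fun _ : Fin N => rademacher) (X := fun _ x => x)
      fun _ => aemeasurable_id).precomp (g := ((↑) : I → Fin N)) Subtype.val_injective
  have hmean : ∀ i (f : G), ∫ ω, g i ω f ∂Pr = excessRisk P ℓ fstar f := fun i f => by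
    rw [← hI.same_excessRisk i i.2 f (hGF f), excessRisk, integral_map (hZ i).aemeasurable]
    exact ((hℓ_meas f (hGF f)).sub (hℓ_meas fstar hfs)).aestronglyMeasurable
  have hvar : ∀ i (f : G), variance (fun ω => g i ω f) Pr ≤ L ^ 2 * r ^ 2 := fun i f => by
    refine (variance_le_expectation_sq (hg2 i f).1).trans ?_
    have h1 := integral_sq_le_of_eLpNorm_le (hh2 i f).1 hr.le (hhnorm i f)
    calc ∫ ω, (g i ω f) ^ 2 ∂Pr ≤ ∫ ω, L ^ 2 * (h i ω f) ^ 2 ∂Pr := by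
          refine integral_mono (hg2 i f).integrable_sq ((hh2 i f).integrable_sq.const_mul _)
            fun ω => ?_
          simp only
          rw [← sq_abs, ← sq_abs (h i ω f), ← mul_pow]
          exact pow_le_pow_left₀ (abs_nonneg _) (hgh i ω f) 2
      _ ≤ L ^ 2 * r ^ 2 := by
          rw [integral_const_mul]
          gcongr
  -- The quotient equals `9 A² L² / (4 n r²)`, at most `9 / (4 · 368)` by the lower bound on `r²`.
  have hv : L ^ 2 * r ^ 2 / (n * τ ^ 2) ≤ 1 / 32 := by
    have h1 : 368 * A ^ 2 * L ^ 2 ≤ n * r ^ 2 := by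
      have e : (S : ℝ) / N = 1 / n := by
        rw [← hnSR]
        field_simp
      rw [e, mul_one_div, div_le_iff₀ hnR] at hr2
      linarith
    have h2 : n * τ ^ 2 = n * r ^ 2 * r ^ 2 * 4 / (9 * A ^ 2) := by
      rw [hτ]
      field_simp
      norm_num
    rw [div_le_iff₀ (by positivity), h2, ← mul_div_assoc, le_div_iff₀ (by positivity)]
    have h3 := mul_le_mul_of_nonneg_right h1 (sq_nonneg r)
    have h4 : 0 ≤ A ^ 2 * L ^ 2 * r ^ 2 := by positivity
    nlinarith
  set J : Finset (Fin N) := K.biUnion B with hJ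
  have hdisj : (K : Set (Fin S)).PairwiseDisjoint B := fun s _ t _ hst => hB.disjoint hst
  have hJcard : (J.card : ℝ) = n * K.card := by
    rw [hJ, Finset.card_biUnion hdisj, Finset.sum_congr rfl fun s _ => hBn s,
      Finset.sum_const, smul_eq_mul]
    push_cast
    ring
  have hJI : J ⊆ I := Finset.biUnion_subset.2 fun s hs => mem_informativeBlocks.1 hs
  have hJN : (N : ℝ) / 2 ≤ J.card := by
    rw [hJcard, ← hnSR]
    have := mul_le_mul_of_nonneg_left hKcard hnR.le
    have := mul_pos hnR hSR
    linarith
  -- The constant 384 is exactly what is needed: `8L / (nτ) · r² n |K| / (384 A L) = 12 |K| / 384`.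
  have hrad : 8 * L / (n * τ) * ∫ p, maxCoord (∑ s ∈ K, ∑ i ∈ b s, σ i p.2 • h i p.1)
      ∂(Pr.prod (Measure.pi fun _ : Fin N => rademacher)) ≤ K.card / 32 := by
    have hint : ∫ p, maxCoord (∑ s ∈ K, ∑ i ∈ b s, σ i p.2 • h i p.1)
        ∂(Pr.prod (Measure.pi fun _ : Fin N => rademacher))
        ≤ (384 * A * L)⁻¹ * r ^ 2 * J.card := by
      refine integral_le_of_lintegral_ofReal_le (by positivity)
        (le_trans (lintegral_mono fun p => ?_) (hcomp J hJI hJN))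
      obtain ⟨f, hf⟩ := exists_eq_maxCoord (∑ s ∈ K, ∑ i ∈ b s, σ i p.2 • h i p.1)
      refine le_trans ?_ (le_iSup₂ (f := fun f
        (_ : f ∈ localClass (P.map Prod.fst) F φ fstar ρ r) => ENNReal.ofReal
          |∑ i ∈ J, p.2 i * (f (X i p.1) - fstar (X i p.1))|) (f : 𝒳 → ℝ) (hG f.2))
      refine ENNReal.ofReal_le_ofReal (le_trans (le_of_eq ?_) (le_abs_self _))
      rw [hf, hJ, Finset.sum_biUnion hdisj]
      simp only [Finset.sum_apply, Pi.smul_apply, smul_eq_mul]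
      refine Finset.sum_congr rfl fun s hs => ?_
      exact hbsum s hs fun i => p.2 i * ((f : 𝒳 → ℝ) (X i p.1) - fstar (X i p.1))
    refine (mul_le_mul_of_nonneg_left hint (by positivity)).trans_eq ?_
    rw [hJcard, hτ]
    field_simp
    ring
  have main := measureReal_exists_card_bad_blocks_le hgm hhm hσm hg2
    (fun i => Integrable.of_eval fun f => (hh2 i f).integrable one_le_two) hlaw
    (hI.indep.comp (fun _ => _) fun _ => hgz) (hI.indep.comp (fun _ => _) fun _ => hhz) iσ
    (fun i ω f f' => by
      have := hℓ.lipschitz f (hGF f) f' (hGF f') (X i ω) (Y i ω)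
      simpa only [hg, hh, sub_sub_sub_cancel_right] using this)
    hL.le hτ0 hn0 K b
    (fun s _ t _ hst => by
      rw [Finset.disjoint_left]
      intro i hi hi'
      exact Finset.disjoint_left.1 (hB.disjoint hst) (Finset.mem_subtype.1 hi)
        (Finset.mem_subtype.1 hi'))
    hbcard hvar hv hrad
  -- From `|K| ≥ 4S / 7`, the exponent `|K| / 288` is at least `S / 504`.
  refine (measureReal_mono ?_).trans (main.trans (Real.exp_le_exp.2 (by linarith)))
  intro ω hω
  simp only [Set.mem_iUnion] at hω
  obtain ⟨f, hf, hω⟩ := hω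
  refine ⟨⟨f, hf⟩, le_trans hω (Nat.cast_le.2 (Finset.card_le_card fun s hs => ?_))⟩
  rw [Finset.mem_filter] at hs ⊢
  refine ⟨hs.1, ?_⟩
  have h1 := hs.2
  have h2 : ∑ i ∈ b s, (g i ω ⟨f, hf⟩ - ∫ ω', g i ω' ⟨f, hf⟩ ∂Pr)
      = n * (blockMean B ℓ (fun i => X i ω) (fun i => Y i ω) fstar f s
        - excessRisk P ℓ fstar f) := by
    simp only [hmean, Finset.sum_sub_distrib, Finset.sum_const, nsmul_eq_mul]
    rw [hbcard s hs.1, blockMean, hBn, ← hbsum s hs.1, mul_sub]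
    simp only [hg]
    rw [← mul_assoc, mul_one_div_cancel hnR.ne', one_mul]
  rw [h2]
  nlinarith

end Event

/-! ### From finite subclasses to the whole localized class -/

section Event

lemma measure_iUnion_le_of_finset {Ω : Type*} [MeasurableSpace Ω] {μ : Measure Ω} {s : ℕ → Set Ω} {c : ℝ≥0∞}
    (h : ∀ m, μ (⋃ k ∈ Finset.range (m + 1), s k) ≤ c) : μ (⋃ k, s k) ≤ c := by
  have hmono : Monotone fun m => ⋃ k ∈ Finset.range (m + 1), s k := fun a b hab =>
    Set.biUnion_subset_biUnion_left fun k hk => by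
      simp only [Finset.mem_range, Finset.mem_coe] at hk ⊢
      exact hk.trans_le (by omega)
  have e : ⋃ k, s k = ⋃ m, ⋃ k ∈ Finset.range (m + 1), s k := by
    refine Set.Subset.antisymm (Set.iUnion_subset fun k => ?_)
      (Set.iUnion_subset fun m => Set.iUnion₂_subset fun k _ => Set.subset_iUnion s k)
    exact (Set.subset_biUnion_of_mem (u := s) (Finset.self_mem_range_succ k)).trans
      (Set.subset_iUnion (fun m => ⋃ k ∈ Finset.range (m + 1), s k) k)
  rw [e, hmono.measure_iUnion]
  exact iSup_le h

variable {Ω 𝒳 𝒴 : Type*} [MeasurableSpace 𝒳] [MeasurableSpace 𝒴] {N S : ℕ}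

/-- If no member of a pointwise dense subclass has many blocks with a large negative deviation, then
more than half of the blocks are good for every member of the class. -/
lemma lt_two_mul_card_good_blocks {P : Measure (𝒳 × 𝒴)} [IsProbabilityMeasure P]
    {E : Submodule ℝ (𝒳 → ℝ)} (hE : IsL2Space (P.map Prod.fst) E)
    {F : Set (𝒳 → ℝ)} (hFE : F ⊆ (E : Set (𝒳 → ℝ)))
    {ℓ : ℝ → 𝒴 → ℝ} {L : ℝ} (hℓ : IsLipschitzConvexLoss F ℓ L)
    (hℓ_meas : ∀ f ∈ F, Measurable fun z : 𝒳 × 𝒴 => ℓ (f z.1) z.2)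
    {fstar : 𝒳 → ℝ} (hfs : fstar ∈ F) {φ : (𝒳 → ℝ) → ℝ} (hN : 0 < N)
    {X : Fin N → Ω → 𝒳} {Y : Fin N → Ω → 𝒴} {I : Finset (Fin N)}
    {B : Fin S → Finset (Fin N)} (hB : IsBlockPartition B)
    (hS : 7 * ((Iᶜ).card : ℝ) / 3 ≤ (S : ℝ)) {ρ r τ : ℝ} (hr : 0 ≤ r) {ω : Ω}
    {u : ℕ → 𝒳 → ℝ} (hu : ∀ n, u n ∈ localClass (P.map Prod.fst) F φ fstar ρ r)
    (hgood : ∀ n, ω ∉ badEvent P ℓ X Y I B fstar τ (u n))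
    {f : 𝒳 → ℝ} (hf : f ∈ localClass (P.map Prod.fst) F φ fstar ρ r)
    (hlim : ∀ x, Tendsto (fun n => u n x) atTop (𝓝 (f x))) :
    S < 2 * (Finset.univ.filter fun s => excessRisk P ℓ fstar f - τ
      ≤ blockMean B ℓ (fun i => X i ω) (fun i => Y i ω) fstar f s).card := by
  classical
  set K := informativeBlocks B I with hK
  set x : Fin N → 𝒳 := fun i => X i ω
  set y : Fin N → 𝒴 := fun i => Y i ω
  have hKcard : 4 / 7 * (S : ℝ) ≤ K.card := by
    have h1 : (S : ℝ) ≤ K.card + (Iᶜ).card := by exact_mod_cast le_card_informativeBlocks hB hN I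
    linarith
  have hrisk := tendsto_excessRisk hE hFE hℓ hℓ_meas hfs hr hu hf hlim
  have hblock : ∀ s, Tendsto (fun n => blockMean B ℓ x y fstar (u n) s) atTop
      (𝓝 (blockMean B ℓ x y fstar f s)) := by
    intro s
    refine Tendsto.const_mul _ (tendsto_finsetSum _ fun i _ => Tendsto.sub_const ?_ _)
    rw [tendsto_iff_norm_sub_tendsto_zero]
    have h1 : Tendsto (fun n => L * |u n (x i) - f (x i)|) atTop (𝓝 0) := by
      have := (((hlim (x i)).sub_const (f (x i))).abs).const_mul L
      simpa using this
    exact squeeze_zero (fun n => norm_nonneg _)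
      (fun n => hℓ.lipschitz _ (hu n).1 _ hf.1 (x i) (y i)) h1
  -- A strict violation for `f` is an open condition and there are finitely many blocks, so one `u
  -- n` inherits all bad blocks of `f`.
  have hev : ∀ᶠ n in atTop, ∀ s, blockMean B ℓ x y fstar f s < excessRisk P ℓ fstar f - τ →
      blockMean B ℓ x y fstar (u n) s < excessRisk P ℓ fstar (u n) - τ := by
    rw [eventually_all]
    intro s
    by_cases hs : blockMean B ℓ x y fstar f s < excessRisk P ℓ fstar f - τ
    · filter_upwards [(hblock s).eventually_lt (hrisk.sub_const τ) hs] with n hn _ using hn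
    · exact Eventually.of_forall fun n h => absurd h hs
  obtain ⟨n, hn⟩ := hev.exists
  have hbad : ((K.filter fun s => ¬ excessRisk P ℓ fstar f - τ
      ≤ blockMean B ℓ x y fstar f s).card : ℝ) < K.card / 8 := by
    refine lt_of_le_of_lt (Nat.cast_le.2 (Finset.card_le_card fun s hs => ?_))
      (not_le.1 (hgood n))
    rw [Finset.mem_filter] at hs ⊢
    exact ⟨hs.1, (hn s (not_le.1 hs.2)).le⟩
  have hsplit := Finset.card_filter_add_card_filter_not (s := K)
    fun s => excessRisk P ℓ fstar f - τ ≤ blockMean B ℓ x y fstar f s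
  have hle : (K.filter fun s => excessRisk P ℓ fstar f - τ ≤ blockMean B ℓ x y fstar f s).card
      ≤ (Finset.univ.filter fun s => excessRisk P ℓ fstar f - τ
        ≤ blockMean B ℓ x y fstar f s).card :=
    Finset.card_le_card (Finset.filter_subset_filter _ (Finset.subset_univ K))
  have hsplit' : ((K.filter fun s => excessRisk P ℓ fstar f - τ
      ≤ blockMean B ℓ x y fstar f s).card : ℝ) + ((K.filter fun s => ¬ excessRisk P ℓ fstar f - τ
      ≤ blockMean B ℓ x y fstar f s).card : ℝ) = K.card := by exact_mod_cast hsplit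
  have hle' := (Nat.cast_le (α := ℝ)).2 hle
  -- More than `7/8 · 4/7 = 1/2` of the `S` blocks are good, strictly because `hbad` is strict.
  rw [← Nat.cast_lt (α := ℝ)]
  push_cast
  linarith

end Event

end MinmaxMOM

end

/-! ### Assembly of the theorem -/

open MinmaxMOM in
theorem mainTheorem3 {Ω 𝒳 𝒴 : Type*} [MeasurableSpace Ω] [MeasurableSpace 𝒳] [MeasurableSpace 𝒴]
    (Pr : Measure Ω) [IsProbabilityMeasure Pr]
    (P : Measure (𝒳 × 𝒴)) [IsProbabilityMeasure P]
    (E : Submodule ℝ (𝒳 → ℝ)) (hE : MinmaxMOM.IsL2Space (P.map Prod.fst) E)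
    (F : Set (𝒳 → ℝ)) (hFE : F ⊆ (E : Set (𝒳 → ℝ))) (hF : Convex ℝ F)
    (ℓ : ℝ → 𝒴 → ℝ) (L : ℝ) (hℓ : MinmaxMOM.IsLipschitzConvexLoss F ℓ L)
    (hℓ_meas : ∀ f ∈ F, Measurable fun z : 𝒳 × 𝒴 => ℓ (f z.1) z.2)
    (fstar : 𝒳 → ℝ) (hfstar : MinmaxMOM.IsOracle P ℓ F fstar)
    (φ : (𝒳 → ℝ) → ℝ) (η : ℝ) (hφ : MinmaxMOM.IsRegularizer E F φ η)
    (N S : ℕ) (hN : 0 < N)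
    (X : Fin N → Ω → 𝒳) (Y : Fin N → Ω → 𝒴) (I : Finset (Fin N))
    (hI : MinmaxMOM.IsInformative Pr P ℓ F fstar X Y I)
    (B : Fin S → Finset (Fin N)) (hB : MinmaxMOM.IsBlockPartition B)
    (hS : 7 * ((Iᶜ).card : ℝ) / 3 ≤ (S : ℝ))
    (A : ℝ) (hA : 0 < A)
    (C : ℝ≥0∞) (hC : C = MinmaxMOM.CSr Pr (P.map Prod.fst) F φ fstar X I S η L A)
    (hBern : MinmaxMOM.LocalBernstein P ℓ F φ fstar C (MinmaxMOM.rhoStar φ fstar η A) A)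
    (hmeas : ∀ r : ℝ, 0 < r → MinmaxMOM.IsPointwiseMeasurable
      (MinmaxMOM.localClass (P.map Prod.fst) F φ fstar (MinmaxMOM.rhoStar φ fstar η A) r)) :
    ∃ Ω₀ : Set Ω, MeasurableSet Ω₀ ∧
      ENNReal.ofReal (1 - 2 * Real.exp (-(S : ℝ) / 504)) ≤ Pr Ω₀ ∧
      ∀ ω ∈ Ω₀, ∀ lam : ℝ, C / ENNReal.ofReal (φ fstar) < ENNReal.ofReal lam →
        ∀ fhat : 𝒳 → ℝ,
          MinmaxMOM.IsMinmaxMOM B ℓ F φ lam (fun i => X i ω) (fun i => Y i ω) fhat →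
            φ (fhat - fstar) ≤ η * (4 + 2 / A) * φ fstar ∧
            eLpNorm (fhat - fstar) 2 (P.map Prod.fst)
              ≤ ENNReal.ofReal ((4 + 6 * A) * lam * φ fstar) / C ^ (1 / 2 : ℝ) := by
  classical
  have hL := hℓ.pos
  have hfs := hfstar.1
  have hφs : 0 ≤ φ fstar := hφ.nonneg _ (hFE hfs)
  have hSpos : 0 < S := by
    obtain ⟨s, -⟩ := hB.cover ⟨0, hN⟩
    exact s.pos
  have hNR : (0 : ℝ) < N := Nat.cast_pos.2 hN
  have hSR : (0 : ℝ) < S := Nat.cast_pos.2 hSpos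
  rcases eq_or_ne C ∞ with hCtop | hCtop
  -- For `C = ∞` no `lam` satisfies the strict inequality.
  · refine ⟨Set.univ, MeasurableSet.univ, ?_, fun ω _ lam hlam => ?_⟩
    · rw [measure_univ]
      exact ENNReal.ofReal_le_one.2 (by linarith [Real.exp_pos (-(S : ℝ) / 504)])
    · rw [hCtop, ENNReal.top_div_of_ne_top ENNReal.ofReal_ne_top] at hlam
      exact absurd hlam not_top_lt
  set r : ℝ := Real.sqrt C.toReal with hr
  have hCle : ENNReal.ofReal (368 * A ^ 2 * L ^ 2 * ((S : ℝ) / (N : ℝ))) ≤ C := by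
    rw [hC]
    exact le_max_right _ _
  have hr2 : r ^ 2 = C.toReal := Real.sq_sqrt ENNReal.toReal_nonneg
  have hC2 : C = ENNReal.ofReal (r ^ 2) := by rw [hr2, ENNReal.ofReal_toReal hCtop]
  have hrlow : 368 * A ^ 2 * L ^ 2 * ((S : ℝ) / (N : ℝ)) ≤ r ^ 2 := by
    rw [hr2]
    exact (ENNReal.ofReal_le_iff_le_toReal hCtop).1 hCle
  have hr0 : 0 < r := by
    have h1 : 0 < 368 * A ^ 2 * L ^ 2 * ((S : ℝ) / (N : ℝ)) := by positivity
    exact lt_of_le_of_ne (Real.sqrt_nonneg _) fun h => by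
      rw [← h] at hrlow
      linarith
  have hCsqrt : C ^ (1 / 2 : ℝ) = ENNReal.ofReal r := by
    rw [hC2, ENNReal.ofReal_rpow_of_pos (by positivity), ← Real.sqrt_eq_rpow,
      Real.sqrt_sq hr0.le]
  have hrT : rTilde Pr (P.map Prod.fst) F φ fstar X I η L A ≤ ENNReal.ofReal r := by
    have h1 : rTilde Pr (P.map Prod.fst) F φ fstar X I η L A ^ 2 ≤ ENNReal.ofReal r ^ 2 := by
      rw [← ENNReal.ofReal_pow hr0.le, ← hC2, hC]
      exact le_max_left _ _
    exact (ENNReal.pow_le_pow_left_iff two_ne_zero).1 h1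
  set ρ := rhoStar φ fstar η A with hρ
  set τ := 2 * r ^ 2 / (3 * A) with hτ
  have hcomp : ∀ J ⊆ I, (N : ℝ) / 2 ≤ (J.card : ℝ) →
      rademacherComplexity Pr X fstar (localClass (P.map Prod.fst) F φ fstar ρ r) J
        ≤ ENNReal.ofReal ((384 * A * L)⁻¹ * r ^ 2 * J.card) := fun J hJ hJc =>
    rademacherComplexity_le_of_rTilde_le Pr _ hFE hF hφ hfs X I hL hA hr0 hrT hJ hJc
  obtain ⟨T, hTsub, hTc, hTlim⟩ := hmeas r hr0
  have hfsmem : fstar ∈ localClass (P.map Prod.fst) F φ fstar ρ r := by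
    have hη := hφ.eta_pos
    refine ⟨hfs, by simp, ?_⟩
    rw [sub_self, hφ.zero, hρ, rhoStar]
    positivity
  have hTne : T.Nonempty := by
    obtain ⟨u, hu, -⟩ := hTlim fstar hfsmem
    exact ⟨u 0, hu 0⟩
  obtain ⟨w, rfl⟩ := hTc.exists_eq_range hTne
  have hw : ∀ k, w k ∈ localClass (P.map Prod.fst) F φ fstar ρ r := fun k =>
    hTsub (Set.mem_range_self k)
  set bad : Set Ω := ⋃ k, badEvent P ℓ X Y I B fstar τ (w k) with hbad
  have hprob : Pr bad ≤ ENNReal.ofReal (Real.exp (-(S : ℝ) / 504)) := by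
    refine measure_iUnion_le_of_finset fun m => ?_
    have := measureReal_biUnion_badEvent_le hE hFE hℓ hℓ_meas hfs hN hI hB hS hA hr0 hrlow hcomp
      ((Finset.range (m + 1)).image w)
      (by
        intro f hf
        obtain ⟨k, -, rfl⟩ := Finset.mem_image.1 hf
        exact hw k)
      (Finset.nonempty_range_add_one.image w)
    rw [Finset.set_biUnion_finset_image] at this
    rw [← ofReal_measureReal (measure_ne_top _ _)]
    exact ENNReal.ofReal_le_ofReal this
  -- A measurable hull avoids proving that `bad` is measurable. Only lower deviations are
  -- controlled, so one exponential suffices and the factor 2 is slack.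
  refine ⟨(toMeasurable Pr bad)ᶜ, (measurableSet_toMeasurable Pr bad).compl, ?_, ?_⟩
  · rw [prob_compl_eq_one_sub (measurableSet_toMeasurable Pr bad), measure_toMeasurable]
    have hexp := Real.exp_pos (-(S : ℝ) / 504)
    refine le_trans ?_ (tsub_le_tsub_left hprob 1)
    rw [← ENNReal.ofReal_one, ← ENNReal.ofReal_sub _ hexp.le]
    exact ENNReal.ofReal_le_ofReal (by linarith)
  intro ω hω lam hlam fhat hfhat
  have hω' : ∀ k, ω ∉ badEvent P ℓ X Y I B fstar τ (w k) := fun k hk =>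
    hω (subset_toMeasurable Pr bad (Set.mem_iUnion.2 ⟨k, hk⟩))
  have hC0 : C ≠ 0 := by
    rw [hC2]
    exact (ENNReal.ofReal_pos.2 (by positivity)).ne'
  have hφpos : 0 < φ fstar := lt_of_le_of_ne hφs fun h => by
    rw [← h, ENNReal.ofReal_zero, ENNReal.div_zero hC0] at hlam
    exact not_top_lt hlam
  have hlam' : r ^ 2 < lam * φ fstar := by
    rw [hC2, ← ENNReal.ofReal_div_of_pos hφpos] at hlam
    exact (div_lt_iff₀ hφpos).1 (ENNReal.ofReal_lt_ofReal_iff'.1 hlam).1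
  have hfin : ∀ f ∈ F, eLpNorm (f - fstar) 2 (P.map Prod.fst) ≠ ∞ := fun f hf =>
    (hE _ (E.sub_mem (hFE hf) (hFE hfs))).2.eLpNorm_ne_top
  have hbounds := minmax_bounds_of_good_blocks hE hFE hF hℓ hfstar hφ hA hr0 hφpos hlam'
    (fun f hf hnorm hφf => by
      rw [← hnorm]
      refine hBern f hf ?_ hφf
      rw [hCsqrt, ← hnorm, ENNReal.ofReal_toReal (hfin f hf)])
    (fun f hf => by
      obtain ⟨u, hu, hlim⟩ := hTlim f hf
      refine lt_two_mul_card_good_blocks hE hFE hℓ hℓ_meas hfs hN hB hS hr0.le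
        (fun n => hTsub (hu n)) (fun n => ?_) hf hlim
      obtain ⟨k, hk⟩ := hu n
      rw [← hk]
      exact hω' k)
    hfhat
  refine ⟨hbounds.1, ?_⟩
  rw [hCsqrt, ← ENNReal.ofReal_div_of_pos hr0, ← ENNReal.ofReal_toReal (hfin fhat hfhat.1)]
  exact ENNReal.ofReal_le_ofReal hbounds.2
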